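/- Let $\Phi = C_1 \lor \dots \lor C_M$ be a disjoint DNF over $N \ge 1$ boolean variables $X_1,\dots,X_N$: each clause $C_j$ is a conjunction of a set of literals, and no assignment in $\{0,1\}^N$ satisfies two of the clauses. Let $P$ be a Markovian distribution on $\{0,1\}^N$, $P(y) = P_{\mathrm{init}}(y_1)\prod_{k=1}^{N-1} P_k(y_{k+1}\mid y_k)$, where $P_{\mathrm{init}}$ is a probability vector, each $P_k$ is a $2\times 2$ stochastic matrix, and all entries of $P_{\mathrm{init}}$ and of the $P_k$ are positive. For $x \in \{0,1\}^N$ and $S \subseteq [N]$ let $v(S) = \mathbb{E}_{X\sim P}[\Phi(X) \mid X_S = x_S]$. The problem $\mathrm{SHAP}(\text{d-DNF}, \overrightarrow{\mathrm{MARKOV}})$ is: given $\Phi$, $x$, $i \in [N]$ and the parameters of $P$, compute the SHAP score $$\overrightarrow{\mathrm{SHAP}}(\Phi,x,i,P) = \sum_{S \subseteq [N]\setminus\{i\}} \frac{|S|!\,(N-|S|-1)!}{N!}\,\bigl[v(S\cup\{i\}) - v(S)\bigr].$$ **Theorem.** This problem is in FP: a single program on a random access machine with exact arithmetic (on natural numbers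 for indexing and on real numbers) computes the SHAP score exactly on every instance, in a number of steps that is polynomial in the number $N$ of variables and the number $M$ of clauses; moreover, when the parameters of $P$ are rational, all numbers written during the computation have a bit length that is polynomial in the total bit length of the instance, so that the total bit cost is polynomial too. The same holds if the score is defined by $$\sum_{S \subsetneq [N]} \frac{|S|!\,(N-|S|-1)!}{N!}\,\bigl[v(S) - v(S\setminus\{i\})\bigr].$$ -/

import Mathlib

noncomputable section

namespace ShapMarkov

/-! ### Random access machine over natural numbers and real numbers

The memory consists of arrays, named by natural numbers, of natural numbers (used for indexing
and counting) and of real numbers.  A program is a finite object whose only constants are natural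
numbers; all arithmetic is exact. -/

/-- Memory: `σ.nat a j` and `σ.num a j` are the `j`-th entries of the `a`-th array of natural
numbers and of the `a`-th array of real numbers. -/
structure Store where
  nat : ℕ → ℕ → ℕ
  num : ℕ → ℕ → ℝ

/-- Expressions for natural numbers; `read a e` is the entry of array `a` at the index given by
`e`, and `sub` is truncated subtraction. -/
inductive NatExp where
  | const : ℕ → NatExp
  | read : ℕ → NatExp → NatExp
  | add : NatExp → NatExp → NatExp
  | sub : NatExp → NatExp → NatExp
  | mul : NatExp → NatExp → NatExp

def NatExp.eval (σ : Store) : NatExp → ℕ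
  | .const n => n
  | .read a e => σ.nat a (e.eval σ)
  | .add e₁ e₂ => e₁.eval σ + e₂.eval σ
  | .sub e₁ e₂ => e₁.eval σ - e₂.eval σ
  | .mul e₁ e₂ => e₁.eval σ * e₂.eval σ

/-- Expressions for real numbers; a division by zero returns zero. -/
inductive NumExp where
  | ofNat : NatExp → NumExp
  | read : ℕ → NatExp → NumExp
  | add : NumExp → NumExp → NumExp
  | sub : NumExp → NumExp → NumExp
  | mul : NumExp → NumExp → NumExp
  | div : NumExp → NumExp → NumExp

def NumExp.eval (σ : Store) : NumExp → ℝ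
  | .ofNat e => (e.eval σ : ℝ)
  | .read a e => σ.num a (e.eval σ)
  | .add e₁ e₂ => e₁.eval σ + e₂.eval σ
  | .sub e₁ e₂ => e₁.eval σ - e₂.eval σ
  | .mul e₁ e₂ => e₁.eval σ * e₂.eval σ
  | .div e₁ e₂ => e₁.eval σ / e₂.eval σ

/-- Tests. -/
inductive Test where
  | natLt : NatExp → NatExp → Test
  | numLt : NumExp → NumExp → Test

def Test.Holds (σ : Store) : Test → Prop
  | .natLt e₁ e₂ => e₁.eval σ < e₂.eval σ
  | .numLt e₁ e₂ => e₁.eval σ < e₂.eval σ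

/-- Programs. `setNat a e v` and `setNum a e v` write `v` at index `e` of array `a`;
`branch b c d` is "if `b` then `c` else `d`", and `loop b c` is "while `b` do `c`". -/
inductive Program where
  | skip : Program
  | setNat : ℕ → NatExp → NatExp → Program
  | setNum : ℕ → NatExp → NumExp → Program
  | seq : Program → Program → Program
  | branch : Test → Program → Program → Program
  | loop : Test → Program → Program

def Store.writeNat (σ : Store) (a j v : ℕ) : Store :=
  { σ with nat := Function.update σ.nat a (Function.update (σ.nat a) j v) }

def Store.writeNum (σ : Store) (a j : ℕ) (v : ℝ) : Store :=
  { σ with num := Function.update σ.num a (Function.update (σ.num a) j v) }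

/-- Bit length of a rational number, written as a signed reduced fraction. -/
def ratBits (q : ℚ) : ℕ := q.num.natAbs.size + q.den.size + 1

open Classical in
/-- Bit length of a real number that is rational (and `0` for an irrational number, where it is
never used). -/
def numBits (r : ℝ) : ℕ := if h : ∃ q : ℚ, (q : ℝ) = r then ratBits h.choose else 0

theorem numBits_ratCast (q : ℚ) : numBits (q : ℝ) = ratBits q := by
  have h : ∃ q' : ℚ, (q' : ℝ) = (q : ℝ) := ⟨q, rfl⟩
  have h2 : h.choose = q := Rat.cast_injective h.choose_spec
  simp only [numBits, dif_pos h, h2]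

/-- `Exec c σ t s σ'`: started on the memory `σ`, the program `c` halts with the memory `σ'` after
exactly `t` elementary steps (assignments, tests, and `skip`s), and `s` is the largest bit length
of a number that is written into the memory during this computation (`0` if there is none).
The number of operations in one step is bounded by a constant that depends on the program only,
and the operands are numbers which are part of the input or have been written before. -/
inductive Exec : Program → Store → ℕ → ℕ → Store → Prop where
  | skip (σ : Store) : Exec .skip σ 1 0 σ
  | setNat (a : ℕ) (e v : NatExp) (σ : Store) :
      Exec (.setNat a e v) σ 1 (v.eval σ).size (σ.writeNat a (e.eval σ) (v.eval σ))
  | setNum (a : ℕ) (e : NatExp) (v : NumExp) (σ : Store) :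
      Exec (.setNum a e v) σ 1 (numBits (v.eval σ)) (σ.writeNum a (e.eval σ) (v.eval σ))
  | seq {c d : Program} {σ σ' σ'' : Store} {t t' s s' : ℕ}
      (h : Exec c σ t s σ') (h' : Exec d σ' t' s' σ'') :
      Exec (.seq c d) σ (t + t') (max s s') σ''
  | branchTrue {b : Test} {c d : Program} {σ σ' : Store} {t s : ℕ}
      (hb : b.Holds σ) (h : Exec c σ t s σ') : Exec (.branch b c d) σ (t + 1) s σ'
  | branchFalse {b : Test} {c d : Program} {σ σ' : Store} {t s : ℕ}
      (hb : ¬ b.Holds σ) (h : Exec d σ t s σ') : Exec (.branch b c d) σ (t + 1) s σ'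
  | loopFalse {b : Test} {c : Program} {σ : Store}
      (hb : ¬ b.Holds σ) : Exec (.loop b c) σ 1 0 σ
  | loopTrue {b : Test} {c : Program} {σ σ' σ'' : Store} {t t' s s' : ℕ}
      (hb : b.Holds σ) (h : Exec c σ t s σ') (h' : Exec (.loop b c) σ' t' s' σ'') :
      Exec (.loop b c) σ (t + t' + 1) (max s s') σ''

/-! ### Computational function problems and polynomial time -/

/-- A computational function problem: its instances, their representation by finitely many lists
of natural numbers and of real numbers, the size of an instance, and the required output. -/
structure FunctionProblem where
  Inst : Type
  natData : Inst → List (List ℕ)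
  numData : Inst → List (List ℝ)
  size : Inst → ℕ
  output : Inst → ℝ

/-- The initial memory: the `a`-th lists are stored in the `a`-th arrays, all else is zero. -/
def FunctionProblem.initial (Q : FunctionProblem) (I : Q.Inst) : Store where
  nat := fun a j => ((Q.natData I).getD a []).getD j 0
  num := fun a j => ((Q.numData I).getD a []).getD j 0

/-- The real numbers in the representation of the instance are all rational. -/
def FunctionProblem.IsRational (Q : FunctionProblem) (I : Q.Inst) : Prop :=
  ∀ l ∈ Q.numData I, ∀ r ∈ l, ∃ q : ℚ, (q : ℝ) = r

/-- The bit length of the representation of an instance with rational data. -/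
def FunctionProblem.bitLength (Q : FunctionProblem) (I : Q.Inst) : ℕ :=
  ((Q.natData I).flatten.map fun n => n.size + 1).sum + ((Q.numData I).flatten.map numBits).sum

/-- The problem is in FP (exact real arithmetic, strongly polynomial): one program computes the
output exactly on every instance, in a number of steps that is polynomial in the size of the
instance; and if the numbers in the instance are rational, then all numbers that occur have a bit
length polynomial in the bit length of the instance, so that the total bit cost is polynomial as
well.  The output is read at index `0` of the real array `0`. -/
def FunctionProblem.InFP (Q : FunctionProblem) : Prop :=
  ∃ (c : Program) (p q : Polynomial ℕ), ∀ I : Q.Inst, ∃ (t s : ℕ) (σ : Store),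
    Exec c (Q.initial I) t s σ ∧
    σ.num 0 0 = Q.output I ∧
    t ≤ p.eval (Q.size I) ∧
    (Q.IsRational I → s ≤ q.eval (Q.bitLength I))

/-! ### Disjoint DNFs -/

/-- A clause over `N` boolean variables is a set of literals; `(k, true)` is the variable `X_k`
and `(k, false)` its negation. -/
abbrev Clause (N : ℕ) := Finset (Fin N × Bool)

/-- An assignment satisfies a clause if it satisfies all its literals. -/
def Clause.Sat {N : ℕ} (C : Clause N) (y : Fin N → Bool) : Prop := ∀ l ∈ C, y l.1 = l.2

/-- A disjoint DNF with `M` clauses over `N` boolean variables: no assignment satisfies two of the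
clauses. -/
structure DisjointDNF (N M : ℕ) where
  clause : Fin M → Clause N
  disjoint : ∀ m m' : Fin M, m ≠ m' → ∀ y : Fin N → Bool,
    ¬ ((clause m).Sat y ∧ (clause m').Sat y)

/-- An assignment satisfies a DNF if it satisfies one of the clauses. -/
def DisjointDNF.Sat {N M : ℕ} (Φ : DisjointDNF N M) (y : Fin N → Bool) : Prop :=
  ∃ m, (Φ.clause m).Sat y

open Classical in
/-- The boolean function computed by a DNF, with values `0` and `1`. -/
def DisjointDNF.value {N M : ℕ} (Φ : DisjointDNF N M) (y : Fin N → Bool) : ℝ :=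
  if Φ.Sat y then 1 else 0

/-! ### Markovian distributions over boolean vectors -/

/-- The parameters of a Markovian distribution over boolean vectors `(X_0, …, X_n)` of dimension
`n + 1`: the distribution of `X_0`, and for each `k < n` the stochastic matrix
`trans k a b = P (X_{k+1} = b | X_k = a)`.  All parameters are positive. -/
structure BoolMarkov (n : ℕ) where
  init : Bool → ℝ
  trans : Fin n → Bool → Bool → ℝ
  init_pos : ∀ a, 0 < init a
  init_sum : init false + init true = 1
  trans_pos : ∀ k a b, 0 < trans k a b
  trans_sum : ∀ k a, trans k a false + trans k a true = 1

/-- The probability of a boolean vector. -/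
def BoolMarkov.prob {n : ℕ} (P : BoolMarkov n) (y : Fin (n + 1) → Bool) : ℝ :=
  P.init (y 0) * ∏ k : Fin n, P.trans k (y k.castSucc) (y k.succ)

/-! ### SHAP scores -/

/-- The value function `v(S; f, x, P) = E_{X ~ P} [f X | X_S = x_S]`. -/
def shapValue {n : ℕ} (f : (Fin (n + 1) → Bool) → ℝ) (x : Fin (n + 1) → Bool)
    (P : BoolMarkov n) (S : Finset (Fin (n + 1))) : ℝ :=
  (∑ y : Fin (n + 1) → Bool with ∀ k ∈ S, y k = x k, P.prob y * f y) /
    ∑ y : Fin (n + 1) → Bool with ∀ k ∈ S, y k = x k, P.prob y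

open Nat in
/-- The SHAP score: the Shapley value of the feature `i` in the game `v`, that is, with
`N = n + 1`, the sum over the sets `S` of features not containing `i` of
`|S|! (N - |S| - 1)! / N! * (v (S ∪ {i}) - v S)`. -/
def shap {n : ℕ} (f : (Fin (n + 1) → Bool) → ℝ) (x : Fin (n + 1) → Bool) (i : Fin (n + 1))
    (P : BoolMarkov n) : ℝ :=
  ∑ S ∈ (Finset.univ.erase i).powerset,
    (((S.card)! * (n + 1 - S.card - 1)! : ℕ) : ℝ) / ((n + 1)! : ℕ) *
      (shapValue f x P (insert i S) - shapValue f x P S)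

open Nat in
/-- The other formula in use for the SHAP score: with `N = n + 1`, the sum over the sets `S` of
features of `|S|! (N - |S| - 1)! / N! * (v S - v (S \ {i}))`.  The weight is meaningless for the
set of all features, which is left out. -/
def shapAlt {n : ℕ} (f : (Fin (n + 1) → Bool) → ℝ) (x : Fin (n + 1) → Bool) (i : Fin (n + 1))
    (P : BoolMarkov n) : ℝ :=
  ∑ S ∈ (Finset.univ : Finset (Fin (n + 1))).ssubsets,
    (((S.card)! * (n + 1 - S.card - 1)! : ℕ) : ℝ) / ((n + 1)! : ℕ) *
      (shapValue f x P S - shapValue f x P (S.erase i))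

/-! ### The problem -/

/-- An instance with `n + 1` variables and `M` clauses. -/
structure ShapInstance where
  n : ℕ
  M : ℕ
  dnf : DisjointDNF (n + 1) M
  x : Fin (n + 1) → Bool
  i : Fin (n + 1)
  P : BoolMarkov n

/-- Representation of the boolean part of an instance: the list consisting of the number `N` of
variables, the number `M` of clauses and the feature; the vector `x`; the two incidence tables
(clause `m` and variable `k` at position `m * N + k`) of the positive and of the negative
literals in the clauses. -/
def ShapInstance.natData (I : ShapInstance) : List (List ℕ) :=
  [[I.n + 1, I.M, (I.i : ℕ)],
   List.ofFn fun k => (I.x k).toNat,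
   List.ofFn fun j : Fin (I.M * (I.n + 1)) =>
     if (j.modNat, true) ∈ I.dnf.clause j.divNat then 1 else 0,
   List.ofFn fun j : Fin (I.M * (I.n + 1)) =>
     if (j.modNat, false) ∈ I.dnf.clause j.divNat then 1 else 0]

/-- Representation of the distribution: its parameters. -/
def ShapInstance.numData (I : ShapInstance) : List (List ℝ) :=
  [[I.P.init false, I.P.init true],
   List.ofFn fun k => I.P.trans k false false,
   List.ofFn fun k => I.P.trans k false true,
   List.ofFn fun k => I.P.trans k true false,
   List.ofFn fun k => I.P.trans k true true]

/-- Computing the SHAP score of a disjoint DNF under a Markovian distribution over boolean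
vectors; the size of an instance is the number of variables plus the number of clauses. -/
def shapProblem : FunctionProblem where
  Inst := ShapInstance
  natData := ShapInstance.natData
  numData := ShapInstance.numData
  size := fun I => I.n + 1 + I.M
  output := fun I => shap I.dnf.value I.x I.i I.P

/-- The same problem with the other formula for the SHAP score. -/
def shapAltProblem : FunctionProblem where
  Inst := ShapInstance
  natData := ShapInstance.natData
  numData := ShapInstance.numData
  size := fun I => I.n + 1 + I.M
  output := fun I => shapAlt I.dnf.value I.x I.i I.P

end ShapMarkov

end

noncomputable section

namespace ShapMarkov

/-! Disjointness makes the DNF the sum of its clause indicators (`DisjointDNF.value_eq_sum`), and v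
is linear in the function, so a single clause may be treated at a time. Its indicator is a product
of filters in one variable each. The numerator and the denominator of v(S) are therefore sums over
paths of products of local factors, with and without the filter; both are entries of forward vectors
(`sum_filter_eq_condFwd`). Fixing the variables in S cuts the chain: the conditioned forward vector
factors over the segments between consecutive elements of S (`condFwd_eq`), where an artificial
start and an artificial end close the first and the last segment. Hence v(S) is a product of ratios,
each depending only on the two ends of its segment.

Pairing S with S ∪ {i} turns the score into a signed sum over all sets, positive if i ∈ S, whose
weights depend only on the number of elements other than i. The sign is multiplicative too: exactly
one segment jumps over i if i is not in S, and none otherwise (`chainProd_jumpSign`). So the sum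
over all sets with a given count is a sum of path weights in an acyclic graph, which `table`
computes by last position and count (`sum_chainProd`). The last row of the table gives both scores
(`shap_eq`, `shapAlt_eq`); the two formulas differ by a shift of the weight.

For a fixed left end of a segment the forward vectors are updated while the right end advances, so
the loops over clauses, left ends, right ends and counts take O(M N^3) steps.

For the bit lengths, adding fractions must not accumulate denominators. If D is a common denominator
of the parameters, a segment ratio is a quotient of two fractions over a power of D with divisor in
[0, 1]; it has a denominator determined by the unfiltered vector alone (`exists_hasDen_div`). The
product B of these denominators over all segments has polynomial bit length and serves every clause
(`exists_hasDen_segRatio`). Row k of the table then consists of fractions over B^k of absolute value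
at most 2^k (`table_bound`), and `bitBound` follows. -/

/-! ### Bit lengths of numbers with a common denominator -/

/-- The real number `r` is a fraction with denominator `d`. -/
def HasDen (d : ℕ) (r : ℝ) : Prop := ∃ z : ℤ, r * d = z

theorem HasDen.mono {d e : ℕ} {r : ℝ} (h : HasDen d r) (hde : d ∣ e) : HasDen e r := by
  obtain ⟨z, hz⟩ := h
  obtain ⟨f, rfl⟩ := hde
  exact ⟨z * f, by push_cast; rw [← mul_assoc, hz]⟩

theorem HasDen.add {d : ℕ} {r s : ℝ} (hr : HasDen d r) (hs : HasDen d s) : HasDen d (r + s) := by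
  obtain ⟨z, hz⟩ := hr
  obtain ⟨w, hw⟩ := hs
  exact ⟨z + w, by push_cast; rw [add_mul, hz, hw]⟩

theorem HasDen.mul {d e : ℕ} {r s : ℝ} (hr : HasDen d r) (hs : HasDen e s) :
    HasDen (d * e) (r * s) := by
  obtain ⟨z, hz⟩ := hr
  obtain ⟨w, hw⟩ := hs
  exact ⟨z * w, by push_cast; rw [mul_mul_mul_comm, hz, hw]⟩

theorem HasDen.intCast (d : ℕ) (z : ℤ) : HasDen d z := ⟨z * d, by push_cast; rfl⟩

theorem HasDen.zero (d : ℕ) : HasDen d 0 := by simpa using HasDen.intCast d 0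

theorem HasDen.one (d : ℕ) : HasDen d 1 := by simpa using HasDen.intCast d 1

theorem HasDen.int_mul {d : ℕ} {r : ℝ} (z : ℤ) (hr : HasDen d r) : HasDen d (z * r) := by
  simpa using (HasDen.intCast 1 z).mul hr

theorem HasDen.sum {ι : Type*} {d : ℕ} {f : ι → ℝ} (s : Finset ι) (h : ∀ j ∈ s, HasDen d (f j)) :
    HasDen d (∑ j ∈ s, f j) := by
  classical
  induction s using Finset.induction_on with
  | empty => simpa using HasDen.zero d
  | insert a s ha ih =>
    rw [Finset.sum_insert ha]
    exact (h a (by simp)).add (ih fun j hj => h j (by simp [hj]))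

/-- A quotient of two fractions with the same denominator, whose divisor lies between `0` and
`1`, has a denominator which depends only on the divisor. -/
theorem exists_hasDen_div {d : ℕ} (hd : 0 < d) {s : ℝ} (hs : HasDen d s) (h0 : 0 ≤ s)
    (h1 : s ≤ 1) : ∃ b : ℕ, 0 < b ∧ b ≤ d ∧ ∀ r, HasDen d r → HasDen b (r / s) := by
  have hd' : (0 : ℝ) < d := by exact_mod_cast hd
  obtain ⟨w, hw⟩ := hs
  rcases h0.eq_or_lt with h | h
  -- A vanishing divisor is allowed: the quotient is then 0 by convention.
  · exact ⟨1, one_pos, hd, fun r _ => by rw [← h, div_zero]; exact HasDen.zero 1⟩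
  · have hwpos : 0 < w := by
      have : (0 : ℝ) < w := hw ▸ mul_pos h hd'
      exact_mod_cast this
    lift w to ℕ using hwpos.le
    -- With s = w/d and r = z/d the quotient is z/w, and s ≤ 1 gives w ≤ d.
    refine ⟨w, by exact_mod_cast hwpos, ?_, ?_⟩
    · have : (w : ℝ) ≤ d := by
        have h2 : s * d ≤ 1 * d := mul_le_mul_of_nonneg_right h1 hd'.le
        rw [hw, one_mul] at h2
        exact_mod_cast h2
      exact_mod_cast this
    · rintro r ⟨z, hz⟩
      refine ⟨z, ?_⟩
      have hw' : (w : ℝ) = s * d := by rw [hw]; simp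
      rw [hw', ← hz]
      field_simp

/-- The reduced denominator divides d, so the reduced numerator is at most 2^(g+h). This reduces
every size bound to a magnitude and some denominator, reduced or not. -/
theorem numBits_le {r : ℝ} {d g h : ℕ} (hd : 0 < d) (hdh : d ≤ 2 ^ h) (hr : HasDen d r)
    (hg : |r| ≤ 2 ^ g) : numBits r ≤ g + 2 * h + 3 := by
  obtain ⟨z, hz⟩ := hr
  have hd' : (d : ℝ) ≠ 0 := by exact_mod_cast hd.ne'
  set q : ℚ := (z : ℚ) / (d : ℤ) with hq
  have hqr : (q : ℝ) = r := by
    rw [hq]; push_cast; rw [← hz]; field_simp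
  have hden : q.den ≤ 2 ^ h := by
    have h1 : ((q.den : ℕ) : ℤ) ∣ (d : ℤ) := by
      rw [hq]; simpa [Rat.divInt_eq_div] using Rat.den_dvd z d
    exact (Nat.le_of_dvd hd (by exact_mod_cast h1)).trans hdh
  have hnum : q.num.natAbs ≤ 2 ^ (g + h) := by
    have h2 : ((q.num.natAbs : ℕ) : ℝ) = |r| * q.den := by
      rw [← hqr, ← abs_of_nonneg (Nat.cast_nonneg (α := ℝ) q.den), ← abs_mul]
      have h3 : (q : ℝ) * q.den = q.num := by exact_mod_cast Rat.mul_den_eq_num q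
      rw [h3, Nat.cast_natAbs]; simp
    have h4 : ((q.num.natAbs : ℕ) : ℝ) ≤ 2 ^ (g + h) := by
      rw [h2, pow_add]
      have h5 : (q.den : ℝ) ≤ 2 ^ h := by exact_mod_cast hden
      gcongr
    exact_mod_cast h4
  rw [← hqr, numBits_ratCast, ratBits]
  have h6 : q.num.natAbs.size ≤ g + h + 1 :=
    Nat.size_le.2 (hnum.trans_lt (Nat.pow_lt_pow_right one_lt_two (Nat.lt_succ_self _)))
  have h7 : q.den.size ≤ h + 1 :=
    Nat.size_le.2 (hden.trans_lt (Nat.pow_lt_pow_right one_lt_two (Nat.lt_succ_self _)))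
  omega

theorem size_le_self (n : ℕ) : n.size ≤ n := Nat.size_le.2 Nat.lt_two_pow_self

theorem factorial_le_two_pow (n : ℕ) : n.factorial ≤ 2 ^ (n * n) :=
  (Nat.factorial_le_pow n).trans <| by
    rw [pow_mul]; exact Nat.pow_le_pow_left Nat.lt_two_pow_self.le n

/-- Finitely many rational numbers have a common denominator whose bit length is at most the sum
of their bit lengths. -/
theorem exists_common_den (l : List ℝ) (hl : ∀ r ∈ l, ∃ q : ℚ, (q : ℝ) = r) :
    ∃ D : ℕ, 0 < D ∧ D ≤ 2 ^ (l.map numBits).sum ∧ ∀ r ∈ l, HasDen D r := by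
  induction l with
  | nil => exact ⟨1, one_pos, by simp, by simp⟩
  | cons a l ih =>
    obtain ⟨D, h0, h1, h2⟩ := ih fun r hr => hl r (by simp [hr])
    obtain ⟨q, rfl⟩ := hl a (by simp)
    have hq : HasDen q.den (q : ℝ) := ⟨q.num, by exact_mod_cast Rat.mul_den_eq_num q⟩
    refine ⟨q.den * D, Nat.mul_pos q.den_pos h0, ?_, ?_⟩
    · rw [List.map_cons, List.sum_cons, pow_add, numBits_ratCast]
      refine Nat.mul_le_mul ?_ h1
      refine (Nat.lt_size_self q.den).le.trans (Nat.pow_le_pow_right two_pos ?_)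
      unfold ratBits; omega
    · intro r hr
      rcases List.mem_cons.1 hr with rfl | hr
      · exact hq.mono (dvd_mul_right _ _)
      · exact (h2 r hr).mono (dvd_mul_left _ _)

/-! ### Reasoning about programs -/

/-- Started on `σ`, the program `c` halts after at most `T` steps in a memory with the property
`Q`; under the assumption `R`, no number of more than `V` bits is written. -/
def Runs (R : Prop) (V : ℕ) (c : Program) (σ : Store) (T : ℕ) (Q : Store → Prop) : Prop :=
  ∃ t s σ', Exec c σ t s σ' ∧ t ≤ T ∧ (R → s ≤ V) ∧ Q σ'

section Rules
variable {R : Prop} {V : ℕ}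

theorem Runs.mono {c : Program} {σ : Store} {T T' : ℕ} {Q Q' : Store → Prop}
    (h : Runs R V c σ T Q) (hT : T ≤ T') (hQ : ∀ σ', Q σ' → Q' σ') : Runs R V c σ T' Q' := by
  obtain ⟨t, s, σ', h1, h2, h3, h4⟩ := h
  exact ⟨t, s, σ', h1, h2.trans hT, h3, hQ _ h4⟩

theorem Runs.setNat {a : ℕ} {e v : NatExp} {σ : Store} {Q : Store → Prop}
    (hV : R → (v.eval σ).size ≤ V) (hQ : Q (σ.writeNat a (e.eval σ) (v.eval σ))) :
    Runs R V (.setNat a e v) σ 1 Q :=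
  ⟨1, _, _, .setNat a e v σ, le_rfl, hV, hQ⟩

theorem Runs.setNum {a : ℕ} {e : NatExp} {v : NumExp} {σ : Store} {Q : Store → Prop}
    (hV : R → numBits (v.eval σ) ≤ V) (hQ : Q (σ.writeNum a (e.eval σ) (v.eval σ))) :
    Runs R V (.setNum a e v) σ 1 Q :=
  ⟨1, _, _, .setNum a e v σ, le_rfl, hV, hQ⟩

theorem Runs.seq {c d : Program} {σ : Store} {T T' : ℕ} {Q : Store → Prop}
    (h : Runs R V c σ T fun σ' => Runs R V d σ' T' Q) : Runs R V (.seq c d) σ (T + T') Q := by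
  obtain ⟨t, s, σ', h1, h2, h3, t', s', σ'', h1', h2', h3', h4⟩ := h
  exact ⟨_, _, _, .seq h1 h1', add_le_add h2 h2', fun hR => max_le (h3 hR) (h3' hR), h4⟩

/-- `for a[0] = start, …, bound - 1 do body`. -/
def forLoop (a : ℕ) (start bound : NatExp) (body : Program) : Program :=
  .seq (.setNat a (.const 0) start)
    (.loop (.natLt (.read a (.const 0)) bound)
      (.seq body (.setNat a (.const 0) (.add (.read a (.const 0)) (.const 1)))))

/-- The rule for counting loops with invariant `Inv`, which includes the value of the counter. -/
theorem Runs.forLoop {a : ℕ} {start bound : NatExp} {body : Program} {σ : Store} {T W : ℕ}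
    {Q : Store → Prop} (Inv : ℕ → Store → Prop) (n₀ n : ℕ) (hn₀ : n₀ ≤ n) (hW : n ≤ W)
    (hV : R → n ≤ V) (hstart : start.eval σ = n₀)
    (h0 : Inv n₀ (σ.writeNat a 0 n₀))
    (hInv : ∀ j σ, Inv j σ → σ.nat a 0 = j ∧ bound.eval σ = n)
    (hbody : ∀ j σ, n₀ ≤ j → j < n → Inv j σ →
      Runs R V body σ T fun σ' => σ'.nat a 0 = j ∧ Inv (j + 1) (σ'.writeNat a 0 (j + 1)))
    (hQ : ∀ σ, Inv n σ → Q σ) :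
    Runs R V (forLoop a start bound body) σ (W * (T + 2) + 2) Q := by
  -- Induction on the number d of remaining rounds. A round costs T + 2 steps (test, body,
  -- increment), and the failing test at the end costs one more.
  have key : ∀ d j σ, n₀ ≤ j → j + d = n → Inv j σ →
      Runs R V (.loop (.natLt (.read a (.const 0)) bound)
        (.seq body (.setNat a (.const 0) (.add (.read a (.const 0)) (.const 1))))) σ
        (d * (T + 2) + 1) Q := by
    intro d
    induction d with
    | zero =>
      intro j σ _ hj hI
      obtain rfl : j = n := by omega
      refine ⟨_, _, σ, .loopFalse ?_, by omega, fun _ => Nat.zero_le _, hQ _ hI⟩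
      simp [Test.Holds, NatExp.eval, hInv _ _ hI]
    | succ d ih =>
      intro j σ hj0 hj hI
      obtain ⟨t, s, σ', h1, h2, h3, h4, h5⟩ := hbody j σ hj0 (by omega) hI
      obtain ⟨t', s', σ'', h1', h2', h3', h4'⟩ := ih (j + 1) _ (by omega) (by omega) h5
      have hs : Exec (.setNat a (.const 0) (.add (.read a (.const 0)) (.const 1))) σ' 1
          (j + 1).size (σ'.writeNat a 0 (j + 1)) := by
        have := Exec.setNat a (.const 0) (.add (.read a (.const 0)) (.const 1)) σ'
        simpa [NatExp.eval, h4] using this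
      refine ⟨_, _, _, .loopTrue ?_ (.seq h1 hs) h1', ?_, ?_, h4'⟩
      · simp only [Test.Holds, NatExp.eval, hInv _ _ hI]; omega
      · have : (d + 1) * (T + 2) = d * (T + 2) + (T + 2) := by ring
        omega
      · intro hR
        have := size_le_self (j + 1)
        have := hV hR
        have := h3 hR
        have := h3' hR
        simp only [max_le_iff]
        omega
  have h := Runs.seq (V := V) (R := R) (c := .setNat a (.const 0) start) (σ := σ) (Q := Q)
    (T := 1) (T' := W * (T + 2) + 1) (d := .loop (.natLt (.read a (.const 0)) bound)
      (.seq body (.setNat a (.const 0) (.add (.read a (.const 0)) (.const 1))))) (by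
    refine Runs.setNat ?_ ?_
    · intro hR
      rw [hstart]
      exact (size_le_self _).trans (hn₀.trans (hV hR))
    · rw [hstart]
      refine (key (n - n₀) n₀ _ le_rfl (by omega) h0).mono ?_ fun _ h => h
      have : (n - n₀) * (T + 2) ≤ W * (T + 2) := Nat.mul_le_mul_right _ (by omega)
      omega)
  exact h.mono (by omega) fun _ h => h

end Rules

@[simp] theorem writeNat_nat (σ : Store) (a j v a' j' : ℕ) :
    (σ.writeNat a j v).nat a' j' = if a' = a ∧ j' = j then v else σ.nat a' j' := by
  by_cases h : a' = a
  · subst h; by_cases h' : j' = j <;> simp [Store.writeNat, h']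
  · simp [Store.writeNat, h]

@[simp] theorem writeNat_num (σ : Store) (a j v : ℕ) : (σ.writeNat a j v).num = σ.num := rfl

@[simp] theorem writeNum_num (σ : Store) (a j : ℕ) (v : ℝ) (a' j' : ℕ) :
    (σ.writeNum a j v).num a' j' = if a' = a ∧ j' = j then v else σ.num a' j' := by
  by_cases h : a' = a
  · subst h; by_cases h' : j' = j <;> simp [Store.writeNum, h']
  · simp [Store.writeNum, h]

@[simp] theorem writeNum_nat (σ : Store) (a j : ℕ) (v : ℝ) : (σ.writeNum a j v).nat = σ.nat := rfl

/-! ### Forward vectors of a chain with weights -/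

/-- The forward vector of the chain with weights `T` and filter `u`, started at position `l` in the
state `x (l - 1)`, after `d` steps. -/
def fwd (T : ℕ → Bool → Bool → ℝ) (x : ℕ → Bool) (u : ℕ → Bool → ℝ) (l : ℕ) : ℕ → Bool → ℝ
  | 0, b => if b = x (l - 1) then 1 else 0
  | d + 1, b => u (l + d) b *
      (fwd T x u l d false * T (l + d) false b + fwd T x u l d true * T (l + d) true b)

/-- The filter that lets everything pass. -/
def noFilter : ℕ → Bool → ℝ := fun _ _ => 1

/-- The sign of a segment from position `l` to the position `k + 1` of the variable `k`: it is
negative if the segment jumps over the variable `i`. -/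
def jumpSign (i l k : ℕ) : ℝ := if l ≤ i ∧ i < k then -1 else 1

/-- The signed ratio of the filtered and the unfiltered weight of the segments from position `l`
to the variable `k`. -/
def segRatio (T : ℕ → Bool → Bool → ℝ) (x : ℕ → Bool) (u : ℕ → Bool → ℝ) (i l k : ℕ) : ℝ :=
  jumpSign i l k * (fwd T x u l (k + 1 - l) (x k) / fwd T x noFilter l (k + 1 - l) (x k))

/-- Whether the variable `q` is counted in the size of a set: all except `i` are. -/
def counted (i q : ℕ) : ℕ := if q = i then 0 else 1

/-! ### The table of the dynamic program -/

/-- The table after the contributions of the rows below `L` have been distributed; row `p + 1`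
belongs to the variable `p`. -/
def table (e : ℕ → ℕ) (r : ℕ → ℕ → ℝ) : ℕ → ℕ → ℕ → ℝ
  | 0, k, s => if k = 0 ∧ s = 0 then 1 else 0
  | L + 1, k, s => table e r L k s +
      if L < k ∧ e (k - 1) ≤ s then table e r L L (s - e (k - 1)) * r L (k - 1) else 0

/-- The table pushes contributions forward, as the program does; this is the equivalent pull form,
in which an entry collects the contributions of the earlier rows distributed so far. -/
theorem table_eq_sum (e : ℕ → ℕ) (r : ℕ → ℕ → ℝ) (p s : ℕ) : ∀ L ≤ p + 1,
    table e r L (p + 1) s =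
      if e p ≤ s then ∑ l ∈ Finset.range L, table e r l l (s - e p) * r l p else 0 := by
  intro L
  induction L with
  | zero => simp [table]
  | succ L ih =>
    intro hL
    rw [table, ih (by omega), Finset.sum_range_succ]
    have : L < p + 1 := by omega
    by_cases h : e p ≤ s <;> simp [h, this]

theorem table_succ_self (e : ℕ → ℕ) (r : ℕ → ℕ → ℝ) (p s : ℕ) :
    table e r (p + 1) (p + 1) s =
      if e p ≤ s then ∑ l ∈ Finset.range (p + 1), table e r l l (s - e p) * r l p else 0 :=
  table_eq_sum e r p s _ le_rfl

/-! ### Chains of segments -/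

/-- The position of the last element below `p` of the set `S` of variables. -/
def lastPos (S : Finset ℕ) : ℕ → ℕ
  | 0 => 0
  | p + 1 => if p ∈ S then p + 1 else lastPos S p

/-- The product of the weights of the segments between the elements of `S` below `p`. -/
def chainProd (r : ℕ → ℕ → ℝ) (S : Finset ℕ) : ℕ → ℝ
  | 0 => 1
  | p + 1 => if p ∈ S then chainProd r S p * r (lastPos S p) p else chainProd r S p

theorem lastPos_le (S : Finset ℕ) (p : ℕ) : lastPos S p ≤ p := by
  induction p with
  | zero => simp [lastPos]
  | succ p ih => rw [lastPos]; split_ifs <;> omega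

theorem lt_lastPos {S : Finset ℕ} {q : ℕ} (hq : q ∈ S) {p : ℕ} (hp : q < p) :
    q < lastPos S p := by
  induction p with
  | zero => omega
  | succ p ih =>
    rw [lastPos]
    split_ifs with h
    · exact hp
    · have : q ≠ p := fun h' => h (h' ▸ hq)
      exact ih (by omega)

theorem lastPos_insert (S : Finset ℕ) {q p : ℕ} (h : p ≤ q) :
    lastPos (insert q S) p = lastPos S p := by
  induction p with
  | zero => rfl
  | succ p ih => simp [lastPos, ih (by omega), show p ≠ q by omega]

theorem chainProd_insert (r : ℕ → ℕ → ℝ) (S : Finset ℕ) {q p : ℕ} (h : p ≤ q) :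
    chainProd r (insert q S) p = chainProd r S p := by
  induction p with
  | zero => rfl
  | succ p ih =>
    simp [chainProd, ih (by omega), lastPos_insert S (show p ≤ q by omega), show p ≠ q by omega]

/-- No divisor has to be nonzero, since quotients are multiplicative also under the convention that
division by zero gives zero. -/
theorem chainProd_mul_div (f g h : ℕ → ℕ → ℝ) (S : Finset ℕ) (p : ℕ) :
    chainProd (fun l k => f l k * (g l k / h l k)) S p =
      chainProd f S p * (chainProd g S p / chainProd h S p) := by
  induction p with
  | zero => simp [chainProd]
  | succ p ih =>
    simp only [chainProd, ih]
    split_ifs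
    · rw [mul_div_mul_comm]; ring
    · rfl

/-- Sum of the weights of the sets of given size, sorted by their last position. -/
theorem sum_chainProd (e : ℕ → ℕ) (r : ℕ → ℕ → ℝ) (p : ℕ) : ∀ (s : ℕ) (g : ℕ → ℝ),
    (∑ S ∈ (Finset.range p).powerset,
      if ∑ q ∈ S, e q = s then chainProd r S p * g (lastPos S p) else 0) =
      ∑ l ∈ Finset.range (p + 1), table e r l l s * g l := by
  induction p with
  | zero =>
    intro s g
    by_cases h : s = 0
    · simp [chainProd, lastPos, table, h]
    · simp [chainProd, lastPos, table, h, Ne.symm h]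
  | succ p ih =>
    intro s g
    -- Sets without p reproduce the sum up to p. Sets with p all have last position p + 1 and form
    -- the new summand.
    rw [Finset.range_add_one, Finset.sum_powerset_insert (by simp), Finset.sum_range_succ, ← ih]
    congr 1
    · refine Finset.sum_congr rfl fun S hS => ?_
      have hp : p ∉ S := fun h => by simpa using Finset.mem_powerset.1 hS h
      simp [chainProd, lastPos, hp]
    · rw [table_succ_self]
      have hstep : ∀ S ∈ (Finset.range p).powerset,
          (if ∑ q ∈ insert p S, e q = s then chainProd r (insert p S) (p + 1) *
            g (lastPos (insert p S) (p + 1)) else 0) =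
          if e p ≤ s then (if ∑ q ∈ S, e q = s - e p then
            chainProd r S p * r (lastPos S p) p else 0) * g (p + 1) else 0 := by
        intro S hS
        have hp : p ∉ S := fun h => by simpa using Finset.mem_powerset.1 hS h
        rw [Finset.sum_insert hp]
        simp only [chainProd, lastPos, Finset.mem_insert, true_or, if_true,
          lastPos_insert S le_rfl, chainProd_insert r S le_rfl]
        split_ifs <;> first | rfl | (exfalso; omega) | simp
      rw [Finset.sum_congr rfl hstep]
      by_cases h : e p ≤ s
      · simp only [h, if_true]
        -- The segment ending at p depends on the last position of the rest of the set. It plays the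
        -- role of `g` here, which is why the induction runs over all `g`.
        rw [← Finset.sum_mul, ih (s - e p) fun l => r l p]
      · simp [h]

/-- The sign of a set: a chain of segments jumps over `i` exactly if `i` is not in the set. -/
theorem chainProd_jumpSign (i : ℕ) (S : Finset ℕ) (p : ℕ) :
    chainProd (jumpSign i) S p =
      if i < lastPos S p then (if i ∈ S then 1 else -1) else 1 := by
  induction p with
  | zero => simp [chainProd, lastPos]
  | succ p ih =>
    by_cases hp : p ∈ S
    · simp only [chainProd, lastPos, hp, if_true, ih, jumpSign]
      have hl := lastPos_le S p
      rcases lt_trichotomy p i with h | rfl | h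
      · simp [show ¬ i < lastPos S p by omega, show ¬ i < p by omega, show ¬ i < p + 1 by omega]
      · simp [show ¬ p < lastPos S p by omega, hp]
      · simp only [h, show i < p + 1 by omega, if_true, and_true]
        by_cases h2 : i < lastPos S p
        · simp [h2]
        -- The new segment jumps over i; an element i of S below p would have moved its left end
        -- past i.
        · have : i ∉ S := fun h3 => h2 (lt_lastPos h3 h)
          simp [this, h2, not_lt.1 h2]
    · simp [chainProd, lastPos, hp, ih]

/-- The forward vector of a chain with filter `u` that is conditioned on the variables in `S`. -/
def condFwd (T : ℕ → Bool → Bool → ℝ) (x : ℕ → Bool) (u : ℕ → Bool → ℝ) (S : Finset ℕ)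
    (p : ℕ) (b : Bool) : ℝ :=
  fwd T x (fun k b => if k ∈ S → b = x k then u k b else 0) 0 p b

/-- Factorization of the conditioned forward vector into segments. -/
theorem condFwd_eq (T : ℕ → Bool → Bool → ℝ) (x : ℕ → Bool) (u : ℕ → Bool → ℝ) (S : Finset ℕ)
    (p : ℕ) : ∀ b, condFwd T x u S p b =
      chainProd (fun l k => fwd T x u l (k + 1 - l) (x k)) S p *
        fwd T x u (lastPos S p) (p - lastPos S p) b := by
  induction p with
  | zero => intro b; simp [condFwd, fwd, chainProd, lastPos]
  | succ p ih =>
    intro b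
    obtain ⟨d, hd⟩ : ∃ d, p = lastPos S p + d := ⟨_, (Nat.add_sub_of_le (lastPos_le S p)).symm⟩
    have h1 : p - lastPos S p = d := by omega
    have h2 : p + 1 - lastPos S p = d + 1 := by omega
    have hstep : ∀ b, condFwd T x u S (p + 1) b = if p ∈ S → b = x p then
        chainProd (fun l k => fwd T x u l (k + 1 - l) (x k)) S p *
        fwd T x u (lastPos S p) (d + 1) b else 0 := by
      intro b
      have hf : condFwd T x u S (p + 1) b = (if p ∈ S → b = x p then u p b else 0) *
          (condFwd T x u S p false * T p false b + condFwd T x u S p true * T p true b) := by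
        simp only [condFwd, fwd, zero_add]
      rw [hf, ih, ih, h1, fwd, ← hd]
      split_ifs
      · ring
      · ring
    rw [hstep]
    -- At a conditioned variable only the state `x p` survives, so the vector is a multiple of the
    -- start vector of a new segment.
    by_cases hp : p ∈ S
    · by_cases hb : b = x p
      · subst hb; simp [chainProd, lastPos, hp, fwd, h2]
      · simp [chainProd, lastPos, hp, hb, fwd]
    · simp [chainProd, lastPos, hp, h2]

/-! ### SHAP scores by dynamic programming -/

/-- The transition weights between the positions `0, …, n + 2`: position `k + 1` belongs to the
variable `k`, and the chain starts and ends in additional positions. -/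
def BoolMarkov.weight {n : ℕ} (P : BoolMarkov n) (k : ℕ) (a b : Bool) : ℝ :=
  if k = 0 then P.init b else if h : k - 1 < n then P.trans ⟨k - 1, h⟩ a b else if b then 0 else 1

/-- The vector `x`, followed by `false`. -/
def extend {n : ℕ} (x : Fin (n + 1) → Bool) (k : ℕ) : Bool :=
  if h : k < n + 1 then x ⟨k, h⟩ else false

/-- The filter that lets the states pass which are compatible with the clause. -/
def Clause.filter {n : ℕ} (C : Clause (n + 1)) (k : ℕ) (b : Bool) : ℝ :=
  if h : k < n + 1 then (if ((⟨k, h⟩ : Fin (n + 1)), !b) ∈ C then 0 else 1) else 1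

theorem Clause.sat_iff {N : ℕ} (C : Clause N) (y : Fin N → Bool) :
    C.Sat y ↔ ∀ k, (k, !y k) ∉ C := by
  constructor
  · intro h k hk
    have := h _ hk
    simp at this
  · rintro h ⟨k, b⟩ hl
    by_contra hb
    refine h k ?_
    have : (!y k) = b := by
      revert hb; cases y k <;> cases b <;> simp
    rwa [this]

/-- The forward recursion sums over all paths, by splitting off the last state. The start state at
position 0 is an arbitrary default, harmless because `ht` makes the first transition independent of
it. -/
theorem sum_paths (T : ℕ → Bool → Bool → ℝ) (x : ℕ → Bool) (u : ℕ → Bool → ℝ) (t : Bool → ℝ)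
    (ht : ∀ a b, T 0 a b = t b) (p : ℕ) : ∀ b,
    (∑ y : Fin (p + 1) → Bool, if y (Fin.last p) = b then
      (t (y 0) * ∏ k : Fin p, T (k + 1) (y k.castSucc) (y k.succ)) * ∏ k : Fin (p + 1), u k (y k) else 0) =
      fwd T x u 0 (p + 1) b := by
  induction p with
  | zero =>
    intro b
    rw [← (Equiv.funUnique (Fin 1) Bool).symm.sum_comp]
    cases b <;> cases h : x 0 <;> simp [fwd, ht, h, mul_comm]
  | succ p ih =>
    intro b
    rw [fwd, ← ih, ← ih, ← (Fin.snocEquiv fun _ => Bool).sum_comp, Fintype.sum_prod_type]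
    simp only [Fin.snocEquiv_apply, Fin.snoc_last]
    rw [Finset.sum_eq_single b (by intro c _ hc; simp [hc]) (by simp)]
    simp only [if_true, zero_add]
    rw [Finset.sum_mul, Finset.sum_mul, ← Finset.sum_add_distrib, Finset.mul_sum]
    refine Finset.sum_congr rfl fun y _ => ?_
    rw [Fin.prod_univ_castSucc, Fin.prod_univ_castSucc (n := p + 1)]
    have h0 : (Fin.snoc y b : Fin (p + 2) → Bool) 0 = y 0 := by
      rw [← Fin.castSucc_zero]
      exact Fin.snoc_castSucc (α := fun _ => Bool) b y 0
    have h1 : ∀ k : Fin (p + 1), (Fin.snoc y b : Fin (p + 2) → Bool) k.castSucc = y k :=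
      fun k => Fin.snoc_castSucc (α := fun _ => Bool) b y k
    have h2 : (Fin.snoc y b : Fin (p + 2) → Bool) (Fin.last (p + 1)) = b :=
      Fin.snoc_last (α := fun _ => Bool) b y
    simp only [Fin.succ_castSucc, Fin.succ_last, h1, h2, h0, Fin.val_castSucc, Fin.val_last]
    cases y (Fin.last p) <;> simp <;> ring

variable {n : ℕ}

/-- The variables of a set as natural numbers, together with the end of the chain. -/
def ends (S : Finset (Fin (n + 1))) : Finset ℕ := insert (n + 1) (S.map Fin.valEmbedding)

theorem mem_ends (S : Finset (Fin (n + 1))) (k : Fin (n + 1)) : (k : ℕ) ∈ ends S ↔ k ∈ S := by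
  have := k.isLt
  simp only [ends, Finset.mem_insert, Finset.mem_map, Fin.valEmbedding_apply]
  constructor
  · rintro (h | ⟨a, ha, h⟩)
    · omega
    · rwa [← Fin.ext h]
  · exact fun h => Or.inr ⟨k, h, rfl⟩

theorem sum_filter_eq_condFwd (P : BoolMarkov n) (x : Fin (n + 1) → Bool) (u : ℕ → Bool → ℝ)
    (hu : u (n + 1) false = 1) (S : Finset (Fin (n + 1))) :
    (∑ y : Fin (n + 1) → Bool with ∀ k ∈ S, y k = x k, P.prob y * ∏ k : Fin (n + 1), u k (y k)) =
      condFwd P.weight (extend x) u (ends S) (n + 2) false := by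
  have hx : extend x (n + 1) = false := by simp [extend]
  have hT : ∀ a, P.weight (n + 1) a false = 1 := by simp [BoolMarkov.weight]
  have h1 := sum_paths P.weight (extend x)
    (fun k b => if k ∈ ends S → b = extend x k then u k b else 0) P.init
    (by simp [BoolMarkov.weight]) n
  -- The end of the chain is entered in state `false` with weight 1 from both states, so the last
  -- step merely adds the two entries.
  rw [condFwd, fwd, ← h1, ← h1, zero_add, hT, hT, hx, mul_one, mul_one]
  simp only [implies_true, if_true, hu, one_mul]
  rw [← Finset.sum_add_distrib, Finset.sum_filter]
  refine Finset.sum_congr rfl fun y _ => ?_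
  have hy : ∀ z : ℝ, ((if y (Fin.last n) = false then z else 0) +
      if y (Fin.last n) = true then z else 0) = z := by
    intro z; cases y (Fin.last n) <;> simp
  rw [hy]
  have hext : ∀ k : Fin (n + 1), extend x k = x k := fun k => by
    rw [extend, dif_pos k.isLt]
  have hw : ∀ k : Fin n, P.weight (k + 1) = P.trans k := fun k => by
    funext a b; simp [BoolMarkov.weight]
  simp only [hw, mem_ends, hext]
  by_cases h : ∀ k ∈ S, y k = x k
  · rw [if_pos h]
    congr 1
    refine Finset.prod_congr rfl fun k _ => ?_
    rw [if_pos (h k)]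
  · rw [if_neg h]
    push Not at h
    obtain ⟨k, hk, hk'⟩ := h
    -- One violated condition makes the filter product of the path vanish.
    rw [Finset.prod_eq_zero (Finset.mem_univ k), mul_zero]
    rw [if_neg fun h => hk' (h hk)]

open Classical in
/-- The indicator function of a clause. -/
def Clause.indicator {N : ℕ} (C : Clause N) (y : Fin N → Bool) : ℝ := if C.Sat y then 1 else 0

theorem Clause.indicator_eq_prod (C : Clause (n + 1)) (y : Fin (n + 1) → Bool) :
    C.indicator y = ∏ k : Fin (n + 1), C.filter k (y k) := by
  have h : ∀ k : Fin (n + 1), C.filter k (y k) = if (k, !y k) ∉ C then 1 else 0 := by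
    intro k
    simp only [Clause.filter, Fin.is_lt, dif_pos, Fin.eta]
    split_ifs <;> simp_all
  rw [Finset.prod_congr rfl fun k _ => h k, Finset.prod_boole, Clause.indicator]
  simp only [Clause.sat_iff, Finset.mem_univ, true_imp_iff]

theorem DisjointDNF.value_eq_sum {N M : ℕ} (Φ : DisjointDNF N M) (y : Fin N → Bool) :
    Φ.value y = ∑ m, (Φ.clause m).indicator y := by
  unfold DisjointDNF.value
  split_ifs with h
  · obtain ⟨m, hm⟩ := h
    rw [Finset.sum_eq_single m]
    · simp [Clause.indicator, hm]
    · intro m' _ hne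
      rw [Clause.indicator, if_neg fun h' => Φ.disjoint m' m hne y ⟨h', hm⟩]
    · simp
  · refine (Finset.sum_eq_zero fun m _ => ?_).symm
    rw [Clause.indicator, if_neg fun h' => h ⟨m, h'⟩]

theorem shapValue_sum {M : ℕ} (f : Fin M → (Fin (n + 1) → Bool) → ℝ) (x : Fin (n + 1) → Bool)
    (P : BoolMarkov n) (S : Finset (Fin (n + 1))) :
    shapValue (fun y => ∑ m, f m y) x P S = ∑ m, shapValue (f m) x P S := by
  simp only [shapValue, ← Finset.sum_div, Finset.mul_sum]
  rw [Finset.sum_comm]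

/-- The signed value of a set of variables is the product of the ratios of its segments. -/
theorem chainProd_segRatio (P : BoolMarkov n) (x : Fin (n + 1) → Bool) (C : Clause (n + 1))
    (i : Fin (n + 1)) (S : Finset (Fin (n + 1))) :
    chainProd (segRatio P.weight (extend x) C.filter i) (ends S) (n + 2) =
      (if i ∈ S then 1 else -1) * shapValue C.indicator x P S := by
  have hx : extend x (n + 1) = false := by simp [extend]
  have hmem : n + 1 ∈ ends S := by simp [ends]
  have hlast : lastPos (ends S) (n + 2) = n + 2 := by rw [lastPos, if_pos hmem]
  have hv : ∀ u : ℕ → Bool → ℝ, u (n + 1) false = 1 →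
      chainProd (fun l k => fwd P.weight (extend x) u l (k + 1 - l) (extend x k))
        (ends S) (n + 2) = ∑ y : Fin (n + 1) → Bool with ∀ k ∈ S, y k = x k,
          P.prob y * ∏ k : Fin (n + 1), u k (y k) := by
    intro u hu
    rw [sum_filter_eq_condFwd P x u hu, condFwd_eq, hlast]
    simp [fwd, hx]
  have := chainProd_mul_div (jumpSign i)
    (fun l k => fwd P.weight (extend x) C.filter l (k + 1 - l) (extend x k))
    (fun l k => fwd P.weight (extend x) noFilter l (k + 1 - l) (extend x k)) (ends S) (n + 2)
  rw [hv _ (by simp [Clause.filter]), hv _ rfl, chainProd_jumpSign, hlast,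
    if_pos (by omega)] at this
  simp only [mem_ends, ← Clause.indicator_eq_prod] at this
  refine this.trans ?_
  simp only [noFilter, Finset.prod_const_one, mul_one, shapValue]

/-- The sums over all sets with the same number of variables different from `i`. -/
theorem sum_signed_shapValue (P : BoolMarkov n) (x : Fin (n + 1) → Bool) (C : Clause (n + 1))
    (i : Fin (n + 1)) (s : ℕ) :
    (∑ S : Finset (Fin (n + 1)), if ∑ q ∈ S, counted i q = s then
      (if i ∈ S then 1 else -1) * shapValue C.indicator x P S else 0) =
      table (counted i) (segRatio P.weight (extend x) C.filter i) (n + 2) (n + 2) (s + 1) := by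
  have he : counted i (n + 1) = 1 := by
    have := i.isLt
    simp [counted, show n + 1 ≠ i by omega]
  -- The end of the chain counts as an element, hence column s + 1 for sets with s counted
  -- variables.
  rw [table_succ_self, he, if_pos (by omega), Nat.add_sub_cancel,
    ← sum_chainProd (counted i) (segRatio P.weight (extend x) C.filter i) (n + 1) s
      fun l => segRatio P.weight (extend x) C.filter i l (n + 1)]
  refine Finset.sum_bij (fun S _ => S.map Fin.valEmbedding) ?_ ?_ ?_ ?_
  · intro S _
    rw [Finset.mem_powerset]
    intro q hq
    obtain ⟨a, _, rfl⟩ := Finset.mem_map.1 hq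
    exact Finset.mem_range.2 a.isLt
  · intro S _ S' _ h
    exact Finset.map_injective _ h
  · intro S' hS'
    refine ⟨Finset.univ.filter fun k => (k : ℕ) ∈ S', Finset.mem_univ _, ?_⟩
    ext q
    simp only [Finset.mem_map, Finset.mem_filter, Finset.mem_univ, true_and,
      Fin.valEmbedding_apply]
    constructor
    · rintro ⟨a, ha, rfl⟩; exact ha
    · intro hq
      exact ⟨⟨q, Finset.mem_range.1 (Finset.mem_powerset.1 hS' hq)⟩, hq, rfl⟩
  · intro S _
    have h1 : n + 1 ∈ ends S := Finset.mem_insert_self _ _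
    rw [← chainProd_segRatio, chainProd, if_pos h1, ends,
      chainProd_insert _ _ le_rfl, lastPos_insert _ le_rfl, Finset.sum_map]
    rfl

/-- A weighted sum of the marginal contributions of the variable `i`, in terms of the table. -/
theorem sum_marginal_eq {M : ℕ} (Φ : DisjointDNF (n + 1) M) (x : Fin (n + 1) → Bool)
    (i : Fin (n + 1)) (P : BoolMarkov n) (ω : ℕ → ℝ) :
    (∑ S ∈ (Finset.univ.erase i).powerset,
      ω S.card * (shapValue Φ.value x P (insert i S) - shapValue Φ.value x P S)) =
    ∑ m, ∑ s ∈ Finset.range (n + 1), ω s *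
      table (counted i) (segRatio P.weight (extend x) (Φ.clause m).filter i)
        (n + 2) (n + 2) (s + 1) := by
  have hval : ∀ S, shapValue Φ.value x P S = ∑ m, shapValue (Φ.clause m).indicator x P S := by
    intro S
    rw [← shapValue_sum]
    congr 1
    funext y
    exact Φ.value_eq_sum y
  simp only [← sum_signed_shapValue, Finset.mul_sum]
  have hm : ∀ m, (∑ s ∈ Finset.range (n + 1), ∑ S : Finset (Fin (n + 1)),
      ω s * (if ∑ q ∈ S, counted i q = s then
        (if i ∈ S then 1 else -1) * shapValue (Φ.clause m).indicator x P S else 0)) =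
      ∑ S ∈ (Finset.univ.erase i).powerset, ω S.card *
        (shapValue (Φ.clause m).indicator x P (insert i S) -
          shapValue (Φ.clause m).indicator x P S) := by
    intro m
    rw [Finset.sum_comm]
    -- Each S without i is paired with S ∪ {i}. Both have the same count, since i is not counted,
    -- and opposite signs.
    have hu : (Finset.univ : Finset (Finset (Fin (n + 1)))) =
        (insert i (Finset.univ.erase i)).powerset := by
      rw [Finset.insert_erase (Finset.mem_univ i), Finset.powerset_univ]
    rw [hu, Finset.sum_powerset_insert (by simp), ← Finset.sum_add_distrib]
    refine Finset.sum_congr rfl fun S hS => ?_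
    have hi : i ∉ S := fun h => by simpa using Finset.mem_powerset.1 hS h
    have hc : ∑ q ∈ S, counted i q = S.card := by
      rw [Finset.card_eq_sum_ones]
      refine Finset.sum_congr rfl fun q hq => ?_
      have : q ≠ i := fun h => hi (h ▸ hq)
      simp [counted, Fin.val_inj, this]
    have hlt : S.card < n + 1 := by
      have h1 := Finset.card_le_card (Finset.mem_powerset.1 hS)
      rw [Finset.card_erase_of_mem (Finset.mem_univ i), Finset.card_univ, Fintype.card_fin] at h1
      omega
    have hc' : ∑ q ∈ insert i S, counted i q = S.card := by
      rw [Finset.sum_insert hi, hc]; simp [counted]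
    rw [hc, hc']
    simp only [mul_ite, mul_zero, Finset.sum_ite_eq, Finset.mem_range, hlt, if_true, hi,
      Finset.mem_insert_self, if_false]
    ring
  simp only [hm]
  rw [Finset.sum_comm]
  refine Finset.sum_congr rfl fun S _ => ?_
  rw [hval, hval, ← Finset.sum_sub_distrib, Finset.mul_sum]

/-- The Shapley weight of the sets with `s` elements. -/
def shapWeight (n s : ℕ) : ℝ := ((s.factorial * (n - s).factorial : ℕ) : ℝ) / (n + 1).factorial

theorem shap_eq {M : ℕ} (Φ : DisjointDNF (n + 1) M) (x : Fin (n + 1) → Bool)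
    (i : Fin (n + 1)) (P : BoolMarkov n) :
    shap Φ.value x i P = ∑ m, ∑ s ∈ Finset.range (n + 1), shapWeight n s *
      table (counted i) (segRatio P.weight (extend x) (Φ.clause m).filter i)
        (n + 2) (n + 2) (s + 1) := by
  rw [← sum_marginal_eq, shap]
  refine Finset.sum_congr rfl fun S _ => ?_
  rw [shapWeight, show n + 1 - S.card - 1 = n - S.card by omega]

/-- Only sets containing i have a nonzero difference. Such a set is S ∪ {i} with weight index |S| +
1, and leaving out the full set means |S| < n. -/
theorem shapAlt_eq {M : ℕ} (Φ : DisjointDNF (n + 1) M) (x : Fin (n + 1) → Bool)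
    (i : Fin (n + 1)) (P : BoolMarkov n) :
    shapAlt Φ.value x i P = ∑ m, ∑ s ∈ Finset.range n, shapWeight n (s + 1) *
      table (counted i) (segRatio P.weight (extend x) (Φ.clause m).filter i)
        (n + 2) (n + 2) (s + 1) := by
  have h := sum_marginal_eq Φ x i P fun s => if s < n then shapWeight n (s + 1) else 0
  simp only [Finset.sum_range_succ, lt_irrefl, if_false, zero_mul, add_zero] at h
  refine Eq.trans ?_ (h.trans (Finset.sum_congr rfl fun m _ => Finset.sum_congr rfl fun s hs => by
    rw [if_pos (Finset.mem_range.1 hs)]))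
  have hu : (Finset.univ : Finset (Fin (n + 1))).ssubsets =
      ((insert i (Finset.univ.erase i)).powerset).filter (· ≠ Finset.univ) := by
    ext S
    simp [Finset.insert_erase (Finset.mem_univ i), Finset.ssubset_univ_iff]
  rw [shapAlt, hu, Finset.sum_filter, Finset.sum_powerset_insert (by simp),
    ← Finset.sum_add_distrib]
  refine Finset.sum_congr rfl fun S hS => ?_
  have hi : i ∉ S := fun h => by simpa using Finset.mem_powerset.1 hS h
  have hiff : insert i S ≠ Finset.univ ↔ S.card < n := by
    rw [Ne, ← Finset.card_eq_iff_eq_univ, Finset.card_insert_of_notMem hi, Fintype.card_fin]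
    have h1 := Finset.card_le_card (Finset.mem_powerset.1 hS)
    rw [Finset.card_erase_of_mem (Finset.mem_univ i), Finset.card_univ, Fintype.card_fin] at h1
    omega
  rw [Finset.erase_eq_of_notMem hi, sub_self, mul_zero, ite_self, zero_add,
    Finset.erase_insert hi, Finset.card_insert_of_notMem hi]
  simp only [hiff]
  split_ifs
  · rw [shapWeight, show n + 1 - (S.card + 1) - 1 = n - (S.card + 1) by omega]
  · simp

/-! ### The program

Besides the input, the program uses the following arrays of natural numbers: `5` for factorials,
and `4`, `6`, `7`, `8`, `9`, `10`, `11` for counters, where `6` counts clauses, `7` and `8` count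
the positions and variables at the two ends of a segment, and `9` counts the sizes of sets.  The
arrays `1`, …, `4` of real numbers are completed by the transitions at the two ends of the chain,
the arrays `5` and `6` hold forward vectors, and the array `7` holds the table. -/

namespace Code

def numVars : NatExp := .read 0 (.const 0)
def numClauses : NatExp := .read 0 (.const 1)
def feature : NatExp := .read 0 (.const 2)
def counter (a : ℕ) : NatExp := .read a (.const 0)

/-- The index at which the transition to the current variable is stored. -/
def transIndex : NatExp :=
  .add (.mul (.sub (.const 1) (counter 8)) numVars) (.sub (counter 8) (.const 1))

/-- The filter of the current clause at the current variable, where `tab` is the table of the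
literals that exclude the state. -/
def filterExp (tab : ℕ) : NatExp :=
  .sub (.const 1) (.sub (.read tab (.add (.mul (counter 6) numVars) (counter 8)))
    (.sub (.add (counter 8) (.const 1)) numVars))

def vecIndex (p : NatExp) (b : NatExp) : NatExp := .add (.mul (.const 2) p) b

def forwardExp (a : ℕ) (f : NatExp) (t₀ t₁ : ℕ) : NumExp :=
  .mul (.ofNat f) (.add
    (.mul (.read a (vecIndex (counter 8) (.const 0))) (.read t₀ transIndex))
    (.mul (.read a (vecIndex (counter 8) (.const 1))) (.read t₁ transIndex)))

def forwardStep (a : ℕ) (f₀ f₁ : NatExp) : Program :=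
  .seq (.setNum a (vecIndex (.add (counter 8) (.const 1)) (.const 0)) (forwardExp a f₀ 1 3))
    (.setNum a (vecIndex (.add (counter 8) (.const 1)) (.const 1)) (forwardExp a f₁ 2 4))

def forwardInit (a : ℕ) : Program :=
  .seq (.setNum a (vecIndex (counter 7) (.const 0))
      (.ofNat (.sub (.const 1) (.read 1 (.sub (counter 7) (.const 1))))))
    (.setNum a (vecIndex (counter 7) (.const 1))
      (.ofNat (.read 1 (.sub (counter 7) (.const 1)))))

/-- The two truncated differences add up to |k - i|, which is then capped at 1. -/
def countExp : NatExp :=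
  .sub (.const 1) (.sub (.const 1) (.add (.sub (counter 8) feature) (.sub feature (counter 8))))

/-- Of the two truncated factors, the first is 1 exactly if l ≤ i and otherwise 0, the second is 1
exactly if i < k and otherwise 0. -/
def signExp : NumExp :=
  .sub (.ofNat (.const 1)) (.ofNat (.mul (.const 2) (.mul
    (.sub (.const 1) (.sub (counter 7) feature))
    (.sub (.const 1) (.sub (.add feature (.const 1)) (counter 8))))))

def segExp : NumExp :=
  .mul signExp (.div
    (.read 5 (vecIndex (.add (counter 8) (.const 1)) (.read 1 (counter 8))))
    (.read 6 (vecIndex (.add (counter 8) (.const 1)) (.read 1 (counter 8)))))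

def tableIndex (k s : NatExp) : NatExp := .add (.mul k (.add numVars (.const 1))) s

/-- The loop bound keeps the target column, shifted by the count of the new variable, within the
row. -/
def pushRow : Program :=
  forLoop 9 (.const 0) (.sub (.add numVars (.const 1)) countExp)
    (.setNum 7 (tableIndex (.add (counter 8) (.const 1)) (.add (counter 9) countExp))
      (.add (.read 7 (tableIndex (.add (counter 8) (.const 1)) (.add (counter 9) countExp)))
        (.mul (.read 7 (tableIndex (counter 7) (counter 9))) segExp)))

def segBody : Program :=
  .seq (forwardStep 5 (filterExp 2) (filterExp 3))
    (.seq (forwardStep 6 (.const 1) (.const 1)) pushRow)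

def rowBody : Program :=
  .seq (forwardInit 5) (.seq (forwardInit 6)
    (forLoop 8 (counter 7) (.add numVars (.const 1)) segBody))

def clearTable : Program :=
  forLoop 10 (.const 0) (.mul (.add numVars (.const 2)) (.add numVars (.const 1)))
    (.setNum 7 (counter 10) (.ofNat (.const 0)))

/-- The shift `δ` affects only the Shapley weight; the table column is always one more than the loop
counter, because of the end of the chain. -/
def collect (δ : ℕ) : Program :=
  forLoop 11 (.const 0) (.sub numVars (.const δ))
    (.setNum 0 (.const 0) (.add (.read 0 (.const 0)) (.mul
      (.div (.ofNat (.mul (.read 5 (.add (counter 11) (.const δ)))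
          (.read 5 (.sub (.sub numVars (.const 1)) (.add (counter 11) (.const δ))))))
        (.ofNat (.read 5 numVars)))
      (.read 7 (tableIndex (.add numVars (.const 1)) (.add (counter 11) (.const 1)))))))

def clauseBody (δ : ℕ) : Program :=
  .seq clearTable (.seq (.setNum 7 (.const 0) (.ofNat (.const 1)))
    (.seq (forLoop 7 (.const 0) (.add numVars (.const 1)) rowBody) (collect δ)))

/-- Index N receives the initial distribution for either source state, index N - 1 the transitions
to the end. Entry 0 of array 0 holds an input probability and becomes the accumulator only after it
has been copied. -/
def completeChain : Program :=
  .seq (.setNum 1 numVars (.read 0 (.const 0))) (.seq (.setNum 2 numVars (.read 0 (.const 1)))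
    (.seq (.setNum 3 numVars (.read 0 (.const 0))) (.seq (.setNum 4 numVars (.read 0 (.const 1)))
      (.seq (.setNum 1 (.sub numVars (.const 1)) (.ofNat (.const 1)))
        (.seq (.setNum 3 (.sub numVars (.const 1)) (.ofNat (.const 1)))
          (.setNum 0 (.const 0) (.ofNat (.const 0))))))))

def factorials : Program :=
  .seq (.setNat 5 (.const 0) (.const 1)) (forLoop 4 (.const 0) numVars
    (.setNat 5 (.add (counter 4) (.const 1))
      (.mul (.read 5 (counter 4)) (.add (counter 4) (.const 1)))))

/-- The program for the SHAP score (`δ = 0`) and for its variant (`δ = 1`). -/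
def main (δ : ℕ) : Program :=
  .seq completeChain (.seq factorials (forLoop 6 (.const 0) numClauses (clauseBody δ)))

end Code

/-! ### Values that occur during the computation -/

namespace ShapInstance
variable (I : ShapInstance)

def clauseFilter (m : ℕ) : ℕ → Bool → ℝ :=
  if h : m < I.M then (I.dnf.clause ⟨m, h⟩).filter else noFilter

def vec (u : ℕ → Bool → ℝ) (l d : ℕ) (b : Bool) : ℝ := fwd I.P.weight (extend I.x) u l d b

def seg (m l k : ℕ) : ℝ := segRatio I.P.weight (extend I.x) (I.clauseFilter m) I.i l k

def tab (m L k s : ℕ) : ℝ := table (counted I.i) (I.seg m) L k s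

def contribution (δ m s : ℕ) : ℝ :=
  shapWeight I.n (s + δ) * I.tab m (I.n + 2) (I.n + 2) (s + 1)

/-- The sum that is accumulated after `m` clauses and `s` summands of the next one. -/
def partialScore (δ m s : ℕ) : ℝ :=
  (∑ m' ∈ Finset.range m, ∑ s' ∈ Finset.range (I.n + 1 - δ), I.contribution δ m' s') +
    ∑ s' ∈ Finset.range s, I.contribution δ m s'

end ShapInstance

/-- `V` bounds the bit lengths of all numbers that the program writes, provided that `R`. -/
structure BitBound (R : Prop) (V : ℕ) (δ : ℕ) (I : ShapInstance) : Prop where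
  counter : R → (I.n + 3) * (I.n + 2) + I.M ≤ V
  factorial : R → ∀ j ≤ I.n + 1, j.factorial.size ≤ V
  zero : R → numBits 0 ≤ V
  one : R → numBits 1 ≤ V
  init : R → ∀ b, numBits (I.P.init b) ≤ V
  clauseVec : R → ∀ m l d b, d ≤ I.n + 2 → numBits (I.vec (I.clauseFilter m) l d b) ≤ V
  freeVec : R → ∀ l d b, d ≤ I.n + 2 → numBits (I.vec noFilter l d b) ≤ V
  tab : R → ∀ m L k s, L ≤ k → k ≤ I.n + 2 → numBits (I.tab m L k s) ≤ V
  score : R → ∀ m s, m < I.M → s ≤ I.n + 1 - δ → numBits (I.partialScore δ m s) ≤ V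

/-! ### Verification of the program -/

/-- The arrays that the main loop only reads have their intended contents. -/
structure Ready (I : ShapInstance) (σ : Store) : Prop where
  numVars : σ.nat 0 0 = I.n + 1
  numClauses : σ.nat 0 1 = I.M
  feature : σ.nat 0 2 = I.i
  entity : ∀ k ≤ I.n + 1, σ.nat 1 k = (extend I.x k).toNat
  filterFalse : ∀ m < I.M, ∀ k ≤ I.n + 1,
    ((1 - (σ.nat 2 (m * (I.n + 1) + k) - (k + 1 - (I.n + 1))) : ℕ) : ℝ) = I.clauseFilter m k false
  filterTrue : ∀ m < I.M, ∀ k ≤ I.n + 1,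
    ((1 - (σ.nat 3 (m * (I.n + 1) + k) - (k + 1 - (I.n + 1))) : ℕ) : ℝ) = I.clauseFilter m k true
  weightFF : ∀ k ≤ I.n + 1, σ.num 1 ((1 - k) * (I.n + 1) + (k - 1)) = I.P.weight k false false
  weightFT : ∀ k ≤ I.n + 1, σ.num 2 ((1 - k) * (I.n + 1) + (k - 1)) = I.P.weight k false true
  weightTF : ∀ k ≤ I.n + 1, σ.num 3 ((1 - k) * (I.n + 1) + (k - 1)) = I.P.weight k true false
  weightTT : ∀ k ≤ I.n + 1, σ.num 4 ((1 - k) * (I.n + 1) + (k - 1)) = I.P.weight k true true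
  factorial : ∀ j ≤ I.n + 1, σ.nat 5 j = j.factorial

/-- Frame rule: the intended contents concern only natural arrays up to 5 and real arrays 1 to 4. -/
theorem Ready.congr {I : ShapInstance} {σ σ' : Store} (h : Ready I σ)
    (hn : ∀ a ≤ 5, σ'.nat a = σ.nat a) (hr : ∀ a, 0 < a → a ≤ 4 → σ'.num a = σ.num a) :
    Ready I σ' := by
  obtain ⟨h1, h2, h3, h4, h5, h6, h7, h8, h9, h10, h11⟩ := h
  constructor <;>
  · simp only [hn 0 (by omega), hn 1 (by omega), hn 2 (by omega), hn 3 (by omega), hn 5 le_rfl,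
      hr 1 (by omega) (by omega), hr 2 (by omega) (by omega), hr 3 (by omega) (by omega),
      hr 4 (by omega) (by omega)]
    assumption

theorem Ready.writeNat {I : ShapInstance} {σ : Store} (h : Ready I σ) {a : ℕ} (ha : 5 < a)
    (j v : ℕ) : Ready I (σ.writeNat a j v) :=
  h.congr (fun b hb => by funext q; simp [show b ≠ a by omega]) fun _ _ _ => rfl

theorem Ready.writeNum {I : ShapInstance} {σ : Store} (h : Ready I σ) {a : ℕ}
    (ha : a = 0 ∨ 4 < a) (j : ℕ) (v : ℝ) : Ready I (σ.writeNum a j v) :=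
  h.congr (fun _ _ => rfl) fun b hb hb' => by funext q; simp [show b ≠ a by omega]

/-- The state inside the loop over the clauses. -/
structure InClause (I : ShapInstance) (m : ℕ) (out : ℝ) (G : ℕ → ℕ → ℝ) (σ : Store) : Prop where
  ready : Ready I σ
  clause : σ.nat 6 0 = m
  out : σ.num 0 0 = out
  tab : ∀ k ≤ I.n + 2, ∀ s ≤ I.n + 1, σ.num 7 (k * (I.n + 2) + s) = G k s

/-- The array `a` contains the forward vector from position `l` to position `p`. -/
def VecAt (I : ShapInstance) (a : ℕ) (u : ℕ → Bool → ℝ) (l p : ℕ) (σ : Store) : Prop :=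
  ∀ b : Bool, σ.num a (2 * p + b.toNat) = I.vec u l (p - l) b

theorem VecAt.congr {I : ShapInstance} {a : ℕ} {u : ℕ → Bool → ℝ} {l p : ℕ} {σ σ' : Store}
    (h : VecAt I a u l p σ) (e : σ'.num a = σ.num a) : VecAt I a u l p σ' :=
  fun b => by rw [e, h b]

theorem InClause.writeNat {I : ShapInstance} {m : ℕ} {out : ℝ} {G : ℕ → ℕ → ℝ} {σ : Store}
    (h : InClause I m out G σ) {a : ℕ} (ha : 6 < a) (j v : ℕ) :
    InClause I m out G (σ.writeNat a j v) :=
  ⟨h.ready.writeNat (by omega) j v, by simp [show 6 ≠ a by omega, h.clause], h.out, h.tab⟩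

theorem InClause.congr {I : ShapInstance} {m : ℕ} {out : ℝ} {G G' : ℕ → ℕ → ℝ} {σ : Store}
    (h : InClause I m out G σ) (hG : ∀ k ≤ I.n + 2, ∀ s ≤ I.n + 1, G k s = G' k s) :
    InClause I m out G' σ :=
  ⟨h.ready, h.clause, h.out, fun k hk s hs => (h.tab k hk s hs).trans (hG k hk s hs)⟩

/-- Writing an entry of the table. -/
theorem InClause.writeTab {I : ShapInstance} {m : ℕ} {out : ℝ} {G G' : ℕ → ℕ → ℝ} {σ : Store}
    (h : InClause I m out G σ) {k₀ s₀ : ℕ} {v : ℝ} (hs₀ : s₀ ≤ I.n + 1) (hv : G' k₀ s₀ = v)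
    (hG : ∀ k ≤ I.n + 2, ∀ s ≤ I.n + 1, ¬ (k = k₀ ∧ s = s₀) → G k s = G' k s) :
    InClause I m out G' (σ.writeNum 7 (k₀ * (I.n + 2) + s₀) v) := by
  refine ⟨h.ready.writeNum (by omega) _ _, h.clause, by simp [h.out], fun k hk s hs => ?_⟩
  have hinj : k * (I.n + 2) + s = k₀ * (I.n + 2) + s₀ ↔ k = k₀ ∧ s = s₀ := by
    constructor
    · intro he
      -- Rows have width n + 2 and s ≤ n + 1, so quotient and remainder recover row and column.
      have h1 := congrArg (· / (I.n + 2)) he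
      have h2 := congrArg (· % (I.n + 2)) he
      simp only [Nat.mul_comm _ (I.n + 2), Nat.mul_add_mod, Nat.mul_add_div (show 0 < I.n + 2 by omega),
        Nat.div_eq_of_lt (show s < I.n + 2 by omega),
        Nat.div_eq_of_lt (show s₀ < I.n + 2 by omega),
        Nat.mod_eq_of_lt (show s < I.n + 2 by omega),
        Nat.mod_eq_of_lt (show s₀ < I.n + 2 by omega)] at h1 h2
      omega
    · rintro ⟨rfl, rfl⟩; rfl
  simp only [writeNum_num, true_and, hinj]
  split_ifs with hc
  · rw [← hv, hc.1, hc.2]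
  · rw [h.tab k hk s hs, hG k hk s hs hc]

section Correctness
variable {R : Prop} {V δ : ℕ} {I : ShapInstance}
open Code

theorem eval_countExp {σ : Store} {k : ℕ} (h : Ready I σ) (hk : σ.nat 8 0 = k) :
    countExp.eval σ = counted I.i k := by
  simp only [countExp, counter, Code.feature, NatExp.eval, hk, h.feature, counted]
  split_ifs <;> omega

theorem eval_signExp {σ : Store} {l k : ℕ} (h : Ready I σ) (hl : σ.nat 7 0 = l)
    (hk : σ.nat 8 0 = k) : signExp.eval σ = jumpSign I.i l k := by
  simp only [signExp, counter, Code.feature, NatExp.eval, NumExp.eval, hk, hl, h.feature, jumpSign]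
  split_ifs with hc
  · rw [show 1 - (l - (I.i : ℕ)) = 1 by omega, show 1 - ((I.i : ℕ) + 1 - k) = 1 by omega]
    norm_num
  · rw [show (1 - (l - (I.i : ℕ))) * (1 - ((I.i : ℕ) + 1 - k)) = 0 by
      rw [Nat.mul_eq_zero]; omega]
    norm_num

theorem eval_segExp {σ : Store} {m l k : ℕ} (h : Ready I σ) (hl : σ.nat 7 0 = l)
    (hk : σ.nat 8 0 = k) (hkn : k ≤ I.n + 1) (h5 : VecAt I 5 (I.clauseFilter m) l (k + 1) σ)
    (h6 : VecAt I 6 noFilter l (k + 1) σ) : segExp.eval σ = I.seg m l k := by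
  simp only [segExp, NumExp.eval, eval_signExp h hl hk, vecIndex, counter, NatExp.eval, hk,
    h.entity k hkn, h5 _, h6 _, ShapInstance.seg, segRatio, ShapInstance.vec]

theorem NatExp.eval_writeNum (e : NatExp) (σ : Store) (a j : ℕ) (v : ℝ) :
    e.eval (σ.writeNum a j v) = e.eval σ := by
  induction e <;> simp_all [NatExp.eval]

theorem runs_forwardInit {σ : Store} {l a : ℕ} (u : ℕ → Bool → ℝ) (hB : BitBound R V δ I)
    (h : Ready I σ) (hl : σ.nat 7 0 = l) (hln : l ≤ I.n + 1) :
    Runs R V (forwardInit a) σ 2 fun σ' =>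
      σ'.nat = σ.nat ∧ (∀ a' ≠ a, σ'.num a' = σ.num a') ∧ VecAt I a u l l σ' := by
  have hx : σ.nat 1 (l - 1) = (extend I.x (l - 1)).toNat := h.entity _ (by omega)
  refine Runs.seq (Runs.setNum ?_ (Runs.setNum ?_ ⟨rfl, ?_, ?_⟩))
  · intro hR
    simp only [NumExp.eval, NatExp.eval, counter, hl, hx]
    have h0 := hB.zero hR
    have h1 := hB.one hR
    cases extend I.x (l - 1) <;> simpa
  · intro hR
    simp only [NumExp.eval, NatExp.eval, counter, writeNum_nat, hl, hx]
    have h0 := hB.zero hR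
    have h1 := hB.one hR
    cases extend I.x (l - 1) <;> simpa
  · intro a' ha'
    funext q
    simp [ha']
  · intro b
    simp only [vecIndex, NumExp.eval, NatExp.eval, counter, writeNum_nat, hl, hx, writeNum_num,
      true_and, Nat.sub_self, ShapInstance.vec, fwd]
    cases b <;> cases extend I.x (l - 1) <;> simp

theorem eval_forwardExp {σ : Store} {l k a t₀ t₁ : ℕ} {u : ℕ → Bool → ℝ} {f : NatExp} {b : Bool}
    (h : Ready I σ) (hk : σ.nat 8 0 = k) (hlk : l ≤ k) (hv : VecAt I a u l k σ)
    (hf : (f.eval σ : ℝ) = u k b)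
    (h₀ : σ.num t₀ ((1 - k) * (I.n + 1) + (k - 1)) = I.P.weight k false b)
    (h₁ : σ.num t₁ ((1 - k) * (I.n + 1) + (k - 1)) = I.P.weight k true b) :
    (forwardExp a f t₀ t₁).eval σ = I.vec u l (k + 1 - l) b := by
  have hv0 := hv false
  have hv1 := hv true
  simp only [Bool.toNat_false, Bool.toNat_true] at hv0 hv1
  simp only [forwardExp, NumExp.eval, vecIndex, transIndex, NatExp.eval, counter, hk,
    Code.numVars, h.numVars, hf, h₀, h₁, hv0, hv1]
  rw [Nat.sub_add_comm hlk]
  simp only [ShapInstance.vec, fwd, Nat.add_sub_of_le hlk]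

theorem runs_forwardStep {σ : Store} {l k a : ℕ} {u : ℕ → Bool → ℝ} {f₀ f₁ : NatExp}
    (ha : 4 < a) (h : Ready I σ) (hk : σ.nat 8 0 = k) (hlk : l ≤ k) (hkn : k ≤ I.n + 1)
    (hv : VecAt I a u l k σ) (hf₀ : (f₀.eval σ : ℝ) = u k false)
    (hf₁ : (f₁.eval σ : ℝ) = u k true)
    (hV : R → ∀ b, numBits (I.vec u l (k + 1 - l) b) ≤ V) :
    Runs R V (forwardStep a f₀ f₁) σ 2 fun σ' =>
      σ'.nat = σ.nat ∧ (∀ a' ≠ a, σ'.num a' = σ.num a') ∧ VecAt I a u l (k + 1) σ' := by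
  have e₀ := eval_forwardExp h hk hlk hv hf₀ (h.weightFF k hkn) (h.weightTF k hkn)
  refine Runs.seq (T := 1) (T' := 1) ?_
  refine Runs.setNum (fun hR => by rw [e₀]; exact hV hR _) ?_
  rw [e₀]
  simp only [vecIndex, counter, NatExp.eval, hk]
  set σ₁ := σ.writeNum a (2 * (k + 1) + 0) (I.vec u l (k + 1 - l) false) with hσ₁
  have h₁ : Ready I σ₁ := h.writeNum (by omega) _ _
  -- The first write goes to position k + 1, so the second expression still reads the old vector at
  -- position k.
  have hv₁ : VecAt I a u l k σ₁ := by
    intro b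
    rw [hσ₁, writeNum_num, if_neg, hv b]
    have : b.toNat ≤ 1 := b.toNat_le
    omega
  have e₁ := eval_forwardExp h₁ (show σ₁.nat 8 0 = k from hk) hlk hv₁
    (f := f₁) (b := true) (by rw [hσ₁, NatExp.eval_writeNum, hf₁])
    (h₁.weightFT k hkn) (h₁.weightTT k hkn)
  refine Runs.setNum (fun hR => by rw [e₁]; exact hV hR _) ⟨rfl, ?_, ?_⟩
  · intro a' ha'
    funext q
    simp [hσ₁, ha']
  · intro b
    rw [e₁]
    simp only [NatExp.eval, writeNum_num, hσ₁, writeNum_nat, hk, true_and]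
    cases b <;> simp

/-- The state in the innermost loop. -/
structure InRow (I : ShapInstance) (m l k : ℕ) (out : ℝ) (G : ℕ → ℕ → ℝ) (σ : Store) : Prop where
  inClause : InClause I m out G σ
  left : σ.nat 7 0 = l
  right : σ.nat 8 0 = k
  clauseVec : VecAt I 5 (I.clauseFilter m) l (k + 1) σ
  freeVec : VecAt I 6 noFilter l (k + 1) σ

theorem InRow.writeNat {m l k : ℕ} {out : ℝ} {G : ℕ → ℕ → ℝ} {σ : Store}
    (h : InRow I m l k out G σ) {a : ℕ} (ha : 8 < a) (j v : ℕ) :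
    InRow I m l k out G (σ.writeNat a j v) :=
  ⟨h.inClause.writeNat (by omega) _ _, by simp [show 7 ≠ a by omega, h.left],
    by simp [show 8 ≠ a by omega, h.right], h.clauseVec, h.freeVec⟩

theorem runs_pushRow {σ : Store} {m l k : ℕ} {out : ℝ} {G : ℕ → ℕ → ℝ} {W : ℕ}
    (h : InRow I m l k out G σ) (hlk : l ≤ k) (hkn : k ≤ I.n + 1) (hW : I.n + 2 ≤ W)
    (hV : R → I.n + 2 ≤ V)
    (hG : R → ∀ s, numBits (G (k + 1) (s + counted I.i k) + G l s * I.seg m l k) ≤ V) :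
    Runs R V pushRow σ (W * (1 + 2) + 2) (InRow I m l k out fun k' s =>
      G k' s + if k' = k + 1 ∧ counted I.i k ≤ s then
        G l (s - counted I.i k) * I.seg m l k else 0) := by
  set e := counted I.i k with he
  have he1 : e ≤ 1 := by rw [he, counted]; split_ifs <;> omega
  refine Runs.forLoop (fun j σ' => InRow I m l k out (fun k' s =>
      G k' s + if k' = k + 1 ∧ e ≤ s ∧ s < j + e then G l (s - e) * I.seg m l k else 0) σ' ∧
      σ'.nat 9 0 = j) 0 (I.n + 2 - e) (Nat.zero_le _) (by omega) (fun hR => ?_) rfl ?_ ?_ ?_ ?_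
  · have := hV hR; omega
  · refine ⟨?_, by simp⟩
    have h' := h.writeNat (a := 9) (by omega) 0 0
    refine ⟨h'.inClause.congr fun k' _ s _ => ?_, h'.left, h'.right, h'.clauseVec, h'.freeVec⟩
    rw [if_neg (by omega), add_zero]
  · rintro j σ' ⟨h', hj⟩
    refine ⟨hj, ?_⟩
    simp only [NatExp.eval, Code.numVars, h'.inClause.ready.numVars,
      eval_countExp h'.inClause.ready h'.right]
    omega
  · rintro j σ' - hjn ⟨h', hj⟩
    have hv : ∀ v : ℝ, v = G (k + 1) (j + e) + G l j * I.seg m l k →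
        InRow I m l k out (fun k' s => G k' s + if k' = k + 1 ∧ e ≤ s ∧ s < j + 1 + e then
          G l (s - e) * I.seg m l k else 0)
          (σ'.writeNum 7 ((k + 1) * (I.n + 2) + (j + e)) v) := by
      rintro v rfl
      refine ⟨h'.inClause.writeTab (by omega) ?_ ?_, h'.left, h'.right,
        h'.clauseVec.congr ?_, h'.freeVec.congr ?_⟩
      · rw [if_pos ⟨rfl, by omega, by omega⟩, Nat.add_sub_cancel]
      · intro k' _ s _ hne
        have hiff : (k' = k + 1 ∧ e ≤ s ∧ s < j + e) ↔ (k' = k + 1 ∧ e ≤ s ∧ s < j + 1 + e) := by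
          omega
        simp only [hiff]
      · funext q; simp
      · funext q; simp
    have hval : (NumExp.add
        (.read 7 (tableIndex (.add (counter 8) (.const 1)) (.add (counter 9) countExp)))
        (.mul (.read 7 (tableIndex (counter 7) (counter 9))) segExp)).eval σ' =
        G (k + 1) (j + e) + G l j * I.seg m l k := by
      simp only [NumExp.eval, tableIndex, counter, NatExp.eval, Code.numVars,
        h'.inClause.ready.numVars, h'.left, h'.right, hj,
        eval_countExp h'.inClause.ready h'.right,
        eval_segExp h'.inClause.ready h'.left h'.right hkn h'.clauseVec h'.freeVec]
      rw [← he, show I.n + 1 + 1 = I.n + 2 from rfl,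
        h'.inClause.tab (k + 1) (by omega) (j + e) (by omega),
        h'.inClause.tab l (by omega) j (by omega)]
      -- Neither entry read has been altered yet: the target column is the next one due, and the
      -- source row l differs from k + 1.
      rw [if_neg (by omega), if_neg (by omega), add_zero, add_zero]
    refine Runs.setNum (fun hR => by rw [hval]; exact hG hR j) ⟨hj, ?_⟩
    rw [hval]
    simp only [tableIndex, counter, NatExp.eval, Code.numVars, h'.inClause.ready.numVars, h'.right,
      hj, eval_countExp h'.inClause.ready h'.right]
    exact ⟨(hv _ rfl).writeNat (by omega) _ _, by simp⟩
  · rintro σ' ⟨h', -⟩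
    refine ⟨h'.inClause.congr fun k' _ s hs => ?_, h'.left, h'.right, h'.clauseVec, h'.freeVec⟩
    have hiff : (k' = k + 1 ∧ e ≤ s ∧ s < I.n + 2 - e + e) ↔ (k' = k + 1 ∧ e ≤ s) := by omega
    simp only [hiff]

theorem InClause.of_eq {m : ℕ} {out : ℝ} {G : ℕ → ℕ → ℝ} {σ σ' : Store}
    (h : InClause I m out G σ) (hn : σ'.nat = σ.nat)
    (hr : ∀ a, a ≠ 5 → a ≠ 6 → σ'.num a = σ.num a) : InClause I m out G σ' :=
  ⟨h.ready.congr (fun a _ => by rw [hn]) fun a _ _ => hr a (by omega) (by omega),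
    by rw [hn, h.clause], by rw [hr 0 (by omega) (by omega), h.out],
    by rw [hr 7 (by omega) (by omega)]; exact h.tab⟩

/-- The table while the contributions of row `l` are being distributed, up to row `k`. -/
def ShapInstance.rowTab (I : ShapInstance) (m l k k' s : ℕ) : ℝ :=
  if k' ≤ k then I.tab m (l + 1) k' s else I.tab m l k' s

theorem tab_succ_of_le (m : ℕ) {l k : ℕ} (h : k ≤ l) (s : ℕ) :
    I.tab m (l + 1) k s = I.tab m l k s := by
  rw [ShapInstance.tab, table, if_neg (by omega), add_zero]; rfl

theorem tab_succ_of_lt (m : ℕ) {l k : ℕ} (h : l < k + 1) (s : ℕ) :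
    I.tab m (l + 1) (k + 1) s = I.tab m l (k + 1) s + if counted I.i k ≤ s then
      I.tab m l l (s - counted I.i k) * I.seg m l k else 0 := by
  rw [ShapInstance.tab, table]
  simp only [h, true_and, Nat.add_sub_cancel]
  rfl

theorem runs_segBody {σ : Store} {m l k : ℕ} {out : ℝ} {W : ℕ} (hB : BitBound R V δ I)
    (hm : m < I.M) (h : InClause I m out (I.rowTab m l k) σ) (hl : σ.nat 7 0 = l)
    (hk : σ.nat 8 0 = k) (hlk : l ≤ k) (hkn : k ≤ I.n + 1)
    (h5 : VecAt I 5 (I.clauseFilter m) l k σ) (h6 : VecAt I 6 noFilter l k σ)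
    (hW : I.n + 2 ≤ W) :
    Runs R V segBody σ (2 + (2 + (W * (1 + 2) + 2)))
      (InRow I m l k out (I.rowTab m l (k + 1))) := by
  have hf : ∀ (t : ℕ) (b : Bool), (((1 - (σ.nat t (m * (I.n + 1) + k) - (k + 1 - (I.n + 1))) : ℕ)
      : ℝ) = I.clauseFilter m k b) → ((filterExp t).eval σ : ℝ) = I.clauseFilter m k b := by
    intro t b ht
    simpa only [filterExp, NatExp.eval, counter, Code.numVars, h.ready.numVars, h.clause, hk]
      using ht
  refine Runs.seq ((runs_forwardStep (by omega) h.ready hk hlk hkn h5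
    (hf 2 false (h.ready.filterFalse m hm k hkn)) (hf 3 true (h.ready.filterTrue m hm k hkn))
    (fun hR b => hB.clauseVec hR m l _ b (by omega))).mono le_rfl ?_)
  rintro σ₁ ⟨hn₁, hr₁, hv₁⟩
  have h₁ : InClause I m out (I.rowTab m l k) σ₁ := h.of_eq hn₁ fun a ha _ => hr₁ a ha
  refine Runs.seq ((runs_forwardStep (u := noFilter) (l := l) (by omega) h₁.ready
    (by rw [hn₁, hk]) hlk hkn
    (h6.congr (hr₁ 6 (by omega))) (by simp [NatExp.eval, noFilter])
    (by simp [NatExp.eval, noFilter])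
    (fun hR b => hB.freeVec hR l _ b (by omega))).mono le_rfl ?_)
  rintro σ₂ ⟨hn₂, hr₂, hv₂⟩
  have h₂ : InRow I m l k out (I.rowTab m l k) σ₂ :=
    ⟨h₁.of_eq hn₂ fun a _ ha => hr₂ a ha, by rw [hn₂, hn₁, hl], by rw [hn₂, hn₁, hk],
      hv₁.congr (hr₂ 5 (by omega)), hv₂⟩
  have e₁ : ∀ s, I.rowTab m l k (k + 1) s = I.tab m l (k + 1) s := fun s =>
    if_neg (by omega)
  have e₂ : ∀ s, I.rowTab m l k l s = I.tab m l l s := fun s =>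
    (if_pos hlk).trans (tab_succ_of_le m le_rfl s)
  refine (runs_pushRow h₂ hlk hkn hW (fun hR => ?_) fun hR s => ?_).mono le_rfl fun σ' h' =>
    ⟨h'.inClause.congr fun k' _ s _ => ?_, h'.left, h'.right, h'.clauseVec, h'.freeVec⟩
  · have := hB.counter hR
    nlinarith
  -- Each number written is itself an entry of `tab` at stage l + 1, so the size bound for the table
  -- applies.
  · have := hB.tab hR m (l + 1) (k + 1) (s + counted I.i k) (by omega) (by omega)
    rwa [tab_succ_of_lt m (by omega), if_pos (by omega), Nat.add_sub_cancel, ← e₁, ← e₂] at this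
  · rw [e₂]
    rcases lt_trichotomy k' (k + 1) with hlt | rfl | hgt
    · simp [ShapInstance.rowTab, show k' ≤ k by omega, show k' ≤ k + 1 by omega,
        show k' ≠ k + 1 by omega]
    · rw [e₁, ShapInstance.rowTab, if_pos le_rfl, tab_succ_of_lt m (by omega)]
      simp
    · simp [ShapInstance.rowTab, show ¬ k' ≤ k by omega, show ¬ k' ≤ k + 1 by omega,
        show k' ≠ k + 1 by omega]

theorem runs_rowBody {σ : Store} {m l : ℕ} {out : ℝ} {W : ℕ} (hB : BitBound R V δ I)
    (hm : m < I.M) (h : InClause I m out (I.tab m l) σ) (hl : σ.nat 7 0 = l)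
    (hln : l ≤ I.n + 1) (hW : I.n + 2 ≤ W) :
    Runs R V rowBody σ (2 + (2 + (W * (2 + (2 + (W * (1 + 2) + 2)) + 2) + 2)))
      fun σ' => InClause I m out (I.tab m (l + 1)) σ' ∧ σ'.nat 7 0 = l := by
  refine Runs.seq ((runs_forwardInit (I.clauseFilter m) hB h.ready hl hln).mono le_rfl ?_)
  rintro σ₁ ⟨hn₁, hr₁, hv₁⟩
  have h₁ : InClause I m out (I.tab m l) σ₁ := h.of_eq hn₁ fun a ha _ => hr₁ a ha
  refine Runs.seq ((runs_forwardInit noFilter hB h₁.ready (by rw [hn₁, hl]) hln).mono le_rfl ?_)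
  rintro σ₂ ⟨hn₂, hr₂, hv₂⟩
  have h₂ : InClause I m out (I.tab m l) σ₂ := h₁.of_eq hn₂ fun a _ ha => hr₂ a ha
  refine Runs.forLoop (fun k σ' => InClause I m out (I.rowTab m l k) σ' ∧ σ'.nat 7 0 = l ∧
    VecAt I 5 (I.clauseFilter m) l k σ' ∧ VecAt I 6 noFilter l k σ' ∧ σ'.nat 8 0 = k)
    l (I.n + 2) (by omega) hW (fun hR => ?_) ?_ ?_ ?_ ?_ ?_
  · have := hB.counter hR
    nlinarith
  · simp [counter, NatExp.eval, hn₂, hn₁, hl]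
  · refine ⟨(h₂.writeNat (by omega) _ _).congr fun k' _ s _ => ?_, by simp [hn₂, hn₁, hl],
      hv₁.congr (hr₂ 5 (by omega)), hv₂, by simp⟩
    -- Row l feeds only later rows; the rows up to l agree at stages l and l + 1.
    rw [ShapInstance.rowTab]
    split_ifs with hc
    · exact (tab_succ_of_le m hc s).symm
    · rfl
  · rintro j σ' ⟨h', -, -, -, hj⟩
    exact ⟨hj, by simp [NatExp.eval, Code.numVars, h'.ready.numVars]⟩
  · rintro j σ' hlj hj ⟨h', hl', h5, h6, hk⟩
    refine (runs_segBody hB hm h' hl' hk hlj (by omega) h5 h6 hW).mono le_rfl fun σ'' h'' =>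
      ⟨h''.right, h''.inClause.writeNat (by omega) _ _, by simp [h''.left], h''.clauseVec,
        h''.freeVec, by simp⟩
  · rintro σ' ⟨h', hl', -⟩
    exact ⟨h'.congr fun k' hk' s _ => if_pos hk', hl'⟩

theorem runs_clearTable {σ : Store} {m : ℕ} {out : ℝ} {W : ℕ} (hB : BitBound R V δ I)
    (h : Ready I σ) (hm : σ.nat 6 0 = m) (ho : σ.num 0 0 = out) (hW : I.n + 3 ≤ W) :
    Runs R V clearTable σ (W * W * (1 + 2) + 2) (InClause I m out fun _ _ => 0) := by
  refine Runs.forLoop (fun j σ' => Ready I σ' ∧ σ'.nat 6 0 = m ∧ σ'.num 0 0 = out ∧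
    (∀ q < j, σ'.num 7 q = 0) ∧ σ'.nat 10 0 = j) 0 ((I.n + 3) * (I.n + 2)) (Nat.zero_le _)
    (Nat.mul_le_mul hW (by omega)) (fun hR => ?_) rfl ?_ ?_ ?_ ?_
  · have := hB.counter hR
    omega
  · exact ⟨h.writeNat (by omega) _ _, by simp [hm], ho, fun q hq => absurd hq (by omega), by simp⟩
  · rintro j σ' ⟨h', -, -, -, hj⟩
    exact ⟨hj, by simp [NatExp.eval, Code.numVars, h'.numVars]⟩
  · rintro j σ' - - ⟨h', hm', ho', hq, hj⟩
    refine Runs.setNum (fun hR => by simpa [NumExp.eval, NatExp.eval] using hB.zero hR) ⟨hj, ?_⟩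
    refine ⟨(h'.writeNum (by omega) _ _).writeNat (by omega) _ _, by simp [hm'], by simp [ho'],
      fun q hq' => ?_, by simp⟩
    simp only [NumExp.eval, NatExp.eval, counter, hj, writeNat_num, writeNum_num, true_and]
    split_ifs with hc
    · simp
    · exact hq q (by omega)
  · rintro σ' ⟨h', hm', ho', hq, -⟩
    refine ⟨h', hm', ho', fun k hk s hs => hq _ ?_⟩
    have : k * (I.n + 2) ≤ (I.n + 2) * (I.n + 2) := Nat.mul_le_mul_right _ hk
    nlinarith

theorem partialScore_succ (m s : ℕ) :
    I.partialScore δ m (s + 1) = I.partialScore δ m s + I.contribution δ m s := by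
  rw [ShapInstance.partialScore, ShapInstance.partialScore, Finset.sum_range_succ, add_assoc]

theorem partialScore_next (m : ℕ) :
    I.partialScore δ m (I.n + 1 - δ) = I.partialScore δ (m + 1) 0 := by
  rw [ShapInstance.partialScore, ShapInstance.partialScore, Finset.sum_range_succ]
  simp

theorem runs_collect {σ : Store} {m : ℕ} {W : ℕ} (hB : BitBound R V δ I) (hm : m < I.M)
    (h : InClause I m (I.partialScore δ m 0) (I.tab m (I.n + 2)) σ) (hW : I.n + 1 ≤ W) :
    Runs R V (collect δ) σ (W * (1 + 2) + 2) fun σ' =>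
      Ready I σ' ∧ σ'.nat 6 0 = m ∧ σ'.num 0 0 = I.partialScore δ (m + 1) 0 := by
  refine Runs.forLoop (fun j σ' => InClause I m (I.partialScore δ m j) (I.tab m (I.n + 2)) σ' ∧
    σ'.nat 11 0 = j) 0 (I.n + 1 - δ) (Nat.zero_le _) (by omega) (fun hR => ?_) rfl ?_ ?_ ?_ ?_
  · have := hB.counter hR
    have : I.n + 1 ≤ (I.n + 3) * (I.n + 2) := by nlinarith
    omega
  · exact ⟨h.writeNat (by omega) _ _, by simp⟩
  · rintro j σ' ⟨h', hj⟩
    exact ⟨hj, by simp [NatExp.eval, Code.numVars, h'.ready.numVars]⟩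
  · rintro j σ' - hjn ⟨h', hj⟩
    have hval : (NumExp.add (.read 0 (.const 0)) (.mul
      (.div (.ofNat (.mul (.read 5 (.add (counter 11) (.const δ)))
          (.read 5 (.sub (.sub Code.numVars (.const 1)) (.add (counter 11) (.const δ))))))
        (.ofNat (.read 5 Code.numVars)))
      (.read 7 (tableIndex (.add Code.numVars (.const 1))
        (.add (counter 11) (.const 1)))))).eval σ' = I.partialScore δ m (j + 1) := by
      simp only [NumExp.eval, tableIndex, counter, NatExp.eval, Code.numVars,
        h'.ready.numVars, hj, h'.out, h'.ready.factorial (I.n + 1) le_rfl,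
        h'.ready.factorial (j + δ) (by omega), Nat.add_sub_cancel,
        h'.ready.factorial (I.n - (j + δ)) (by omega)]
      rw [show I.n + 1 + 1 = I.n + 2 from rfl, h'.tab (I.n + 2) le_rfl (j + 1) (by omega),
        partialScore_succ]
      rfl
    refine Runs.setNum (fun hR => by rw [hval]; exact hB.score hR m _ hm (by omega)) ⟨hj, ?_⟩
    rw [hval]
    refine ⟨⟨(h'.ready.writeNum (by omega) _ _).writeNat (by omega) _ _, by simp [h'.clause],
      by simp [NatExp.eval], ?_⟩, by simp⟩
    simpa using h'.tab
  · rintro σ' ⟨h', -⟩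
    exact ⟨h'.ready, h'.clause, by rw [h'.out, partialScore_next]⟩

theorem runs_clauseBody {σ : Store} {m : ℕ} {W : ℕ} (hB : BitBound R V δ I) (hm : m < I.M)
    (h : Ready I σ) (hc : σ.nat 6 0 = m) (ho : σ.num 0 0 = I.partialScore δ m 0)
    (hW : I.n + 3 ≤ W) :
    Runs R V (clauseBody δ) σ ((W * W * (1 + 2) + 2) + (1 +
        ((W * ((2 + (2 + (W * (2 + (2 + (W * (1 + 2) + 2)) + 2) + 2))) + 2) + 2) +
          (W * (1 + 2) + 2)))) fun σ' =>
      Ready I σ' ∧ σ'.nat 6 0 = m ∧ σ'.num 0 0 = I.partialScore δ (m + 1) 0 := by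
  refine Runs.seq ((runs_clearTable hB h hc ho hW).mono le_rfl fun σ₁ h₁ => ?_)
  refine Runs.seq (Runs.setNum (fun hR => by simpa [NumExp.eval, NatExp.eval] using hB.one hR) ?_)
  have h₂ := h₁.writeTab (G' := I.tab m 0) (k₀ := 0) (s₀ := 0) (v := 1) (Nat.zero_le _)
    (by simp [ShapInstance.tab, table]) (fun k _ s _ hks => by
      rw [ShapInstance.tab, table, if_neg hks])
  rw [zero_mul, zero_add] at h₂
  simp only [NumExp.eval, NatExp.eval, Nat.cast_one]
  refine Runs.seq (Runs.mono (T := W * ((2 + (2 + (W * (2 + (2 + (W * (1 + 2) + 2)) + 2) + 2)))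
    + 2) + 2) ?_ le_rfl fun σ' h' => runs_collect hB hm h' (by omega))
  refine Runs.forLoop (fun l σ' => InClause I m (I.partialScore δ m 0) (I.tab m l) σ' ∧
    σ'.nat 7 0 = l) 0 (I.n + 2) (Nat.zero_le _) (by omega) (fun hR => ?_) rfl ?_ ?_ ?_ ?_
  · have := hB.counter hR
    nlinarith
  · exact ⟨h₂.writeNat (by omega) _ _, by simp⟩
  · rintro j σ' ⟨h', hj⟩
    exact ⟨hj, by simp [NatExp.eval, Code.numVars, h'.ready.numVars]⟩
  · rintro j σ' - hj ⟨h', hl⟩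
    exact (runs_rowBody hB hm h' hl (by omega) (by omega)).mono le_rfl fun σ'' h'' =>
      ⟨h''.2, h''.1.writeNat (by omega) _ _, by simp⟩
  · rintro σ' ⟨h', -⟩
    exact h'

end Correctness

/-! ### Decoding the input and running the whole program -/

theorem getD_ofFn {α : Type*} {n : ℕ} (f : Fin n → α) (k : ℕ) (d : α) :
    (List.ofFn f).getD k d = if h : k < n then f ⟨k, h⟩ else d := by
  rw [List.getD_eq_getElem?_getD, List.getElem?_ofFn]
  split_ifs <;> rfl

/-- The memory with the input. -/
def ShapInstance.input (I : ShapInstance) : Store := shapProblem.initial I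

section Correctness
variable {R : Prop} {V δ : ℕ} {I : ShapInstance}
open Code

theorem input_entity (k : ℕ) : I.input.nat 1 k = (extend I.x k).toNat := by
  refine (getD_ofFn (fun k => (I.x k).toNat) k 0).trans ?_
  unfold extend
  split_ifs <;> rfl

/-- At the end of the chain, k = N, the index overruns the row of the clause. Whatever is read there
is at most 1 and is cancelled by k + 1 - N = 1, so the filter lets everything pass. -/
theorem input_literal (b : Bool) (f : ℕ → ℕ)
    (hf : f = fun j => (List.ofFn fun j : Fin (I.M * (I.n + 1)) =>
      if (j.modNat, b) ∈ I.dnf.clause j.divNat then 1 else 0).getD j 0) (m : ℕ) (hm : m < I.M)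
    (k : ℕ) (hk : k ≤ I.n + 1) :
    ((1 - (f (m * (I.n + 1) + k) - (k + 1 - (I.n + 1))) : ℕ) : ℝ) = I.clauseFilter m k (!b) := by
  have hle : ∀ q, f q ≤ 1 := by
    intro q
    rw [hf]
    simp only [getD_ofFn]
    split_ifs <;> omega
  rw [ShapInstance.clauseFilter, dif_pos hm, Clause.filter]
  by_cases h1 : k < I.n + 1
  · have hlt : m * (I.n + 1) + k < I.M * (I.n + 1) := by nlinarith
    have hdiv : (⟨m * (I.n + 1) + k, hlt⟩ : Fin (I.M * (I.n + 1))).divNat = ⟨m, hm⟩ := by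
      ext
      simp only [Fin.coe_divNat]
      rw [mul_comm, Nat.mul_add_div (by omega), Nat.div_eq_of_lt h1, add_zero]
    have hmod : (⟨m * (I.n + 1) + k, hlt⟩ : Fin (I.M * (I.n + 1))).modNat = ⟨k, h1⟩ := by
      ext
      simp only [Fin.coe_modNat]
      rw [mul_comm, Nat.mul_add_mod, Nat.mod_eq_of_lt h1]
    rw [hf, dif_pos h1, Bool.not_not]
    simp only [getD_ofFn, dif_pos hlt, hdiv, hmod]
    split_ifs
    · simp [show k + 1 - (I.n + 1) = 0 by omega]
    · simp
  · have h3 : f (m * (I.n + 1) + k) - (k + 1 - (I.n + 1)) = 0 := by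
      have := hle (m * (I.n + 1) + k)
      omega
    rw [h3, dif_neg h1]
    simp

/-- The index is N for k = 0 and k - 1 otherwise. The nested conditions describe an input array
after index n and index n + 1 have been overwritten. -/
theorem input_trans (f : ℕ → ℝ) (a b : Bool)
    (hf : f = fun j => (List.ofFn fun k => I.P.trans k a b).getD j 0) (k : ℕ)
    (hk : k ≤ I.n + 1) :
    (if (1 - k) * (I.n + 1) + (k - 1) = I.n then (if b then 0 else 1) else
      if (1 - k) * (I.n + 1) + (k - 1) = I.n + 1 then I.P.init b else
        f ((1 - k) * (I.n + 1) + (k - 1))) = I.P.weight k a b := by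
  rcases Nat.eq_zero_or_pos k with rfl | hpos
  · simp [BoolMarkov.weight]
  · rw [show (1 - k) * (I.n + 1) + (k - 1) = k - 1 by rw [show 1 - k = 0 by omega]; omega]
    rw [BoolMarkov.weight, if_neg hpos.ne', if_neg (show k - 1 ≠ I.n + 1 by omega), hf]
    simp only [getD_ofFn]
    by_cases h : k - 1 < I.n
    · rw [if_neg h.ne, dif_pos h, dif_pos h]
    · rw [if_pos (by omega), dif_neg h]

theorem runs_completeChain (hB : BitBound R V δ I) :
    Runs R V completeChain I.input 7 fun σ => σ.nat = I.input.nat ∧ σ.num 0 0 = 0 ∧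
      (∀ k ≤ I.n + 1, σ.num 1 ((1 - k) * (I.n + 1) + (k - 1)) = I.P.weight k false false) ∧
      (∀ k ≤ I.n + 1, σ.num 2 ((1 - k) * (I.n + 1) + (k - 1)) = I.P.weight k false true) ∧
      (∀ k ≤ I.n + 1, σ.num 3 ((1 - k) * (I.n + 1) + (k - 1)) = I.P.weight k true false) ∧
      ∀ k ≤ I.n + 1, σ.num 4 ((1 - k) * (I.n + 1) + (k - 1)) = I.P.weight k true true := by
  have hN : I.input.nat 0 0 = I.n + 1 := rfl
  have hi0 : I.input.num 0 0 = I.P.init false := rfl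
  have hi1 : I.input.num 0 1 = I.P.init true := rfl
  refine Runs.seq (T := 1) (T' := 6) (Runs.setNum (fun hR => ?_) ?_)
  · simpa [NumExp.eval, NatExp.eval, hi0] using hB.init hR false
  refine Runs.seq (T := 1) (T' := 5) (Runs.setNum (fun hR => ?_) ?_)
  · simpa [NumExp.eval, NatExp.eval, hi1] using hB.init hR true
  refine Runs.seq (T := 1) (T' := 4) (Runs.setNum (fun hR => ?_) ?_)
  · simpa [NumExp.eval, NatExp.eval, hi0] using hB.init hR false
  refine Runs.seq (T := 1) (T' := 3) (Runs.setNum (fun hR => ?_) ?_)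
  · simpa [NumExp.eval, NatExp.eval, hi1] using hB.init hR true
  refine Runs.seq (T := 1) (T' := 2) (Runs.setNum (fun hR => ?_) ?_)
  · simpa [NumExp.eval, NatExp.eval] using hB.one hR
  refine Runs.seq (T := 1) (T' := 1) (Runs.setNum (fun hR => ?_) ?_)
  · simpa [NumExp.eval, NatExp.eval] using hB.one hR
  refine Runs.setNum (fun hR => ?_) ⟨rfl, ?_, fun k hk => ?_, fun k hk => ?_, fun k hk => ?_,
    fun k hk => ?_⟩
  · simpa [NumExp.eval, NatExp.eval] using hB.zero hR
  · simp [NumExp.eval, NatExp.eval]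
  · rw [← input_trans (I.input.num 1) false false rfl k hk]
    simp [NumExp.eval, NatExp.eval, Code.numVars, hN, hi0]
  · rw [← input_trans (I.input.num 2) false true rfl k hk]
    -- Index n is not written in this array: the default 0 beyond the input is the weight of
    -- entering the end in state `true`.
    have h0 : I.input.num 2 I.n = 0 :=
      (getD_ofFn (fun k => I.P.trans k false true) I.n 0).trans (dif_neg (lt_irrefl _))
    simp only [NumExp.eval, NatExp.eval, Code.numVars, hN, hi1, writeNum_num, writeNum_nat]
    simp only [OfNat.ofNat_ne_zero, OfNat.ofNat_ne_one, false_and, if_false, true_and,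
      Nat.reduceEqDiff, OfNat.zero_ne_ofNat, zero_ne_one]
    split_ifs <;> first | omega | rfl | (rename_i h; rw [h]; exact h0)
  · rw [← input_trans (I.input.num 3) true false rfl k hk]
    simp [NumExp.eval, NatExp.eval, Code.numVars, hN, hi0]
  · rw [← input_trans (I.input.num 4) true true rfl k hk]
    have h0 : I.input.num 4 I.n = 0 :=
      (getD_ofFn (fun k => I.P.trans k true true) I.n 0).trans (dif_neg (lt_irrefl _))
    simp only [NumExp.eval, NatExp.eval, Code.numVars, hN, hi1, writeNum_num, writeNum_nat]
    simp only [OfNat.ofNat_ne_zero, OfNat.ofNat_ne_one, false_and, if_false, true_and,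
      Nat.reduceEqDiff, OfNat.zero_ne_ofNat, zero_ne_one]
    split_ifs <;> first | omega | rfl | (rename_i h; rw [h]; exact h0)

theorem runs_factorials {σ : Store} {W : ℕ} (hB : BitBound R V δ I) (hN : σ.nat 0 0 = I.n + 1)
    (hW : I.n + 1 ≤ W) :
    Runs R V factorials σ (1 + (W * (1 + 2) + 2)) fun σ' => (∀ a ≤ 3, σ'.nat a = σ.nat a) ∧
      σ'.num = σ.num ∧ ∀ j ≤ I.n + 1, σ'.nat 5 j = j.factorial := by
  have hw : ∀ (τ : Store) (a j v : ℕ), 3 < a → (∀ a ≤ 3, τ.nat a = σ.nat a) →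
      ∀ a' ≤ 3, (τ.writeNat a j v).nat a' = σ.nat a' := by
    intro τ a j v ha h a' ha'
    rw [← h a' ha']
    funext q
    simp [show a' ≠ a by omega]
  refine Runs.seq (Runs.setNat (fun hR => ?_) ?_)
  · simpa [NatExp.eval] using hB.factorial hR 0 (Nat.zero_le _)
  refine Runs.forLoop (fun j σ' => (∀ a ≤ 3, σ'.nat a = σ.nat a) ∧ σ'.num = σ.num ∧
    (∀ q ≤ j, σ'.nat 5 q = q.factorial) ∧ σ'.nat 4 0 = j) 0 (I.n + 1) (Nat.zero_le _) hW
    (fun hR => ?_) rfl ?_ ?_ ?_ ?_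
  · have := hB.counter hR
    nlinarith
  · refine ⟨hw _ _ _ _ (by omega) (hw _ _ _ _ (by omega) fun _ _ => rfl), rfl, fun q hq => ?_,
      by simp⟩
    obtain rfl : q = 0 := by omega
    simp [NatExp.eval]
  · rintro j σ' ⟨h', -, -, hj⟩
    exact ⟨hj, by simp [NatExp.eval, Code.numVars, h' 0 (by omega), hN]⟩
  · rintro j σ' - hjn ⟨h', hnum, hq, hj⟩
    have hval : (NatExp.mul (.read 5 (counter 4)) (.add (counter 4) (.const 1))).eval σ' =
        (j + 1).factorial := by
      simp only [NatExp.eval, counter, hj, hq j le_rfl, Nat.factorial_succ, mul_comm]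
    refine Runs.setNat (fun hR => ?_) ?_
    · rw [hval]; exact hB.factorial hR (j + 1) (by omega)
    rw [hval]
    simp only [NatExp.eval, counter, hj]
    refine ⟨by simp [hj], hw _ _ _ _ (by omega) (hw _ _ _ _ (by omega) h'), hnum,
      fun q hq' => ?_, by simp⟩
    simp only [writeNat_nat, Nat.reduceEqDiff, false_and, if_false, true_and]
    split_ifs with h1
    · rw [h1]
    · exact hq q (by omega)
  · rintro σ' ⟨h', hnum, hq, -⟩
    exact ⟨h', hnum, hq⟩

theorem runs_main {W : ℕ} (hB : BitBound R V δ I) (hW : I.n + 3 ≤ W) (hM : I.M ≤ W) :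
    Runs R V (main δ) I.input (7 + ((1 + (W * (1 + 2) + 2)) + (W * (((W * W * (1 + 2) + 2) + (1 +
        ((W * ((2 + (2 + (W * (2 + (2 + (W * (1 + 2) + 2)) + 2) + 2))) + 2) + 2) +
          (W * (1 + 2) + 2)))) + 2) + 2))) fun σ =>
      σ.num 0 0 = I.partialScore δ I.M 0 := by
  refine Runs.seq ((runs_completeChain hB).mono le_rfl ?_)
  rintro σ₁ ⟨hn₁, ho₁, hff, hft, htf, htt⟩
  refine Runs.seq ((runs_factorials hB (by rw [hn₁]; rfl) (show I.n + 1 ≤ W by omega)).mono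
    le_rfl ?_)
  rintro σ₂ ⟨hn₂, hr₂, hfac⟩
  have hready : Ready I σ₂ :=
    { numVars := by rw [hn₂ 0 (by omega), hn₁]; rfl
      numClauses := by rw [hn₂ 0 (by omega), hn₁]; rfl
      feature := by rw [hn₂ 0 (by omega), hn₁]; rfl
      entity := fun k _ => by rw [hn₂ 1 (by omega), hn₁, input_entity]
      filterFalse := by
        rw [hn₂ 2 (by omega), hn₁]; exact input_literal true (I.input.nat 2) rfl
      filterTrue := by
        rw [hn₂ 3 (by omega), hn₁]; exact input_literal false (I.input.nat 3) rfl
      weightFF := by rw [hr₂]; exact hff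
      weightFT := by rw [hr₂]; exact hft
      weightTF := by rw [hr₂]; exact htf
      weightTT := by rw [hr₂]; exact htt
      factorial := hfac }
  refine Runs.forLoop (fun m σ' => Ready I σ' ∧ σ'.num 0 0 = I.partialScore δ m 0 ∧
    σ'.nat 6 0 = m) 0 I.M (Nat.zero_le _) hM (fun hR => ?_) rfl ?_ ?_ ?_ ?_
  · have := hB.counter hR
    omega
  · exact ⟨hready.writeNat (by omega) _ _, by simp [hr₂, ho₁, ShapInstance.partialScore], by simp⟩
  · rintro j σ' ⟨h', -, hj⟩
    exact ⟨hj, by simp [NatExp.eval, Code.numClauses, h'.numClauses]⟩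
  · rintro j σ' - hj ⟨h', ho', hm⟩
    exact (runs_clauseBody hB hj h' hm ho' hW).mono le_rfl fun σ'' h'' =>
      ⟨h''.2.1, h''.1.writeNat (by omega) _ _, by simp [h''.2.2], by simp⟩
  · rintro σ' ⟨-, ho', -⟩
    exact ho'

end Correctness

/-! ### Bounds for the bit lengths -/

section Bounds

/-- The transition weights `T` are stochastic matrices. -/
structure IsStochastic (T : ℕ → Bool → Bool → ℝ) : Prop where
  nonneg : ∀ k a b, 0 ≤ T k a b
  sum_eq_one : ∀ k a, T k a false + T k a true = 1

variable {T : ℕ → Bool → Bool → ℝ} {x : ℕ → Bool} {u : ℕ → Bool → ℝ}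

theorem fwd_nonneg (hT : IsStochastic T) (hu : ∀ k b, u k b = 0 ∨ u k b = 1) (l d : ℕ) :
    ∀ b, 0 ≤ fwd T x u l d b := by
  induction d with
  | zero => intro b; unfold fwd; positivity
  | succ d ih =>
    intro b
    have hu0 : 0 ≤ u (l + d) b := by rcases hu (l + d) b with h | h <;> rw [h]; exact zero_le_one
    exact mul_nonneg hu0 (add_nonneg (mul_nonneg (ih _) (hT.nonneg _ _ _))
      (mul_nonneg (ih _) (hT.nonneg _ _ _)))

theorem noFilter_eq (k : ℕ) (b : Bool) : noFilter k b = 0 ∨ noFilter k b = 1 := Or.inr rfl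

/-- A filter only removes mass; this bounds the segment ratios by 1. -/
theorem fwd_le_noFilter (hT : IsStochastic T) (hu : ∀ k b, u k b = 0 ∨ u k b = 1) (l d : ℕ) :
    ∀ b, fwd T x u l d b ≤ fwd T x noFilter l d b := by
  induction d with
  | zero => intro b; exact le_rfl
  | succ d ih =>
    intro b
    have h1 : fwd T x u l d false * T (l + d) false b + fwd T x u l d true * T (l + d) true b ≤
        fwd T x noFilter l d false * T (l + d) false b +
          fwd T x noFilter l d true * T (l + d) true b :=
      add_le_add (mul_le_mul_of_nonneg_right (ih _) (hT.nonneg _ _ _))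
        (mul_le_mul_of_nonneg_right (ih _) (hT.nonneg _ _ _))
    have h2 : 0 ≤ fwd T x noFilter l (d + 1) b := fwd_nonneg hT noFilter_eq l _ b
    simp only [fwd, noFilter, one_mul] at h2 ⊢
    rcases hu (l + d) b with h | h <;> rw [h]
    · rwa [zero_mul]
    · rwa [one_mul]

theorem fwd_noFilter_sum (hT : IsStochastic T) (l d : ℕ) :
    fwd T x noFilter l d false + fwd T x noFilter l d true = 1 := by
  induction d with
  | zero => unfold fwd; cases x (l - 1) <;> simp
  | succ d ih =>
    have h : ∀ k b, noFilter k b = 1 := fun _ _ => rfl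
    simp only [fwd, h, one_mul]
    linear_combination fwd T x noFilter l d false * hT.sum_eq_one (l + d) false +
      fwd T x noFilter l d true * hT.sum_eq_one (l + d) true + ih

theorem fwd_noFilter_le_one (hT : IsStochastic T) (l d : ℕ) (b : Bool) :
    fwd T x noFilter l d b ≤ 1 := by
  have h := fwd_noFilter_sum (x := x) hT l d
  have h0 := fwd_nonneg (x := x) hT noFilter_eq l d false
  have h1 := fwd_nonneg (x := x) hT noFilter_eq l d true
  cases b <;> linarith

/-- Each transition contributes one factor D, and both summands of a step share the same power. -/
theorem HasDen.fwd {D : ℕ} (hD : ∀ k a b, HasDen D (T k a b))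
    (hu : ∀ k b, u k b = 0 ∨ u k b = 1) (l d : ℕ) :
    ∀ b, HasDen (D ^ d) (fwd T x u l d b) := by
  induction d with
  | zero =>
    intro b
    unfold ShapMarkov.fwd
    split_ifs
    · exact HasDen.one _
    · exact HasDen.zero _
  | succ d ih =>
    intro b
    have h := ((ih false).mul (hD (l + d) false b)).add ((ih true).mul (hD (l + d) true b))
    rw [ShapMarkov.fwd]
    rcases hu (l + d) b with h0 | h0 <;> rw [h0]
    · rw [zero_mul]; exact HasDen.zero _
    · rw [one_mul, pow_succ]; exact h

/-- The ratios of all segments have a common denominator, which does not depend on the filter. -/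
theorem exists_hasDen_segRatio (hT : IsStochastic T) {D : ℕ} (hD0 : 0 < D)
    (hD : ∀ k a b, HasDen D (T k a b)) (i K : ℕ) :
    ∃ B : ℕ, 0 < B ∧ B ≤ D ^ (K * (K * K)) ∧ ∀ u : ℕ → Bool → ℝ,
      (∀ k b, u k b = 0 ∨ u k b = 1) → ∀ l k, l ≤ k → k < K →
        HasDen B (segRatio T x u i l k) ∧ |segRatio T x u i l k| ≤ 1 := by
  have hpow : 0 < D ^ K := pow_pos hD0 K
  have hden : ∀ u : ℕ → Bool → ℝ, (∀ k b, u k b = 0 ∨ u k b = 1) → ∀ l k, k < K →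
      HasDen (D ^ K) (fwd T x u l (k + 1 - l) (x k)) := fun u hu l k hk =>
    (HasDen.fwd hD hu l _ _).mono (pow_dvd_pow D (by omega))
  have hex : ∀ l k, ∃ b : ℕ, 0 < b ∧ b ≤ D ^ K ∧ (k < K → ∀ r, HasDen (D ^ K) r →
      HasDen b (r / fwd T x noFilter l (k + 1 - l) (x k))) := by
    intro l k
    by_cases hk : k < K
    · obtain ⟨b, h1, h2, h3⟩ := exists_hasDen_div hpow (hden _ noFilter_eq l k hk)
        (fwd_nonneg hT noFilter_eq l _ _) (fwd_noFilter_le_one hT l _ _)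
      exact ⟨b, h1, h2, fun _ => h3⟩
    · exact ⟨1, one_pos, hpow, fun h => absurd h hk⟩
  choose b hb0 hb1 hb2 using hex
  -- There are K² pairs of ends, each with a denominator at most D^K.
  refine ⟨∏ p ∈ Finset.range K ×ˢ Finset.range K, b p.1 p.2,
    Finset.prod_pos fun p _ => hb0 _ _, ?_, fun u hu l k hlk hk => ⟨?_, ?_⟩⟩
  · refine (Finset.prod_le_pow_card _ _ _ fun p _ => hb1 p.1 p.2).trans ?_
    rw [Finset.card_product, Finset.card_range, ← pow_mul]
  · have h1 := (hb2 l k hk _ (hden u hu l k hk)).mono (Finset.dvd_prod_of_mem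
      (fun p : ℕ × ℕ => b p.1 p.2) (Finset.mk_mem_product (Finset.mem_range.2 (hlk.trans_lt hk))
        (Finset.mem_range.2 hk)))
    unfold segRatio jumpSign
    split_ifs
    · simpa using h1.int_mul (-1)
    · rwa [one_mul]
  · have h0 := fwd_nonneg (x := x) hT hu l (k + 1 - l) (x k)
    have h1 := fwd_le_noFilter (x := x) hT hu l (k + 1 - l) (x k)
    have h2 : |jumpSign i l k| = 1 := by unfold jumpSign; split_ifs <;> simp
    rw [segRatio, abs_mul, h2, one_mul, abs_of_nonneg (div_nonneg h0 (h0.trans h1))]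
    exact div_le_one_of_le₀ h1 (h0.trans h1)

theorem sum_two_pow_le (L : ℕ) : ∑ l ∈ Finset.range L, (2 : ℝ) ^ l ≤ 2 ^ L := by
  induction L with
  | zero => simp
  | succ L ih => rw [Finset.sum_range_succ, pow_succ]; linarith

/-- An entry of row k is a sum over earlier rows l of entries times ratios: denominators B^l · B
divide B^k, and the bounds 2^l sum to at most 2^k. -/
theorem table_bound {e : ℕ → ℕ} {r : ℕ → ℕ → ℝ} {B K : ℕ}
    (hr : ∀ l k, l ≤ k → k < K → HasDen B (r l k) ∧ |r l k| ≤ 1) (k : ℕ) :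
    k ≤ K → ∀ L ≤ k, ∀ s, HasDen (B ^ k) (table e r L k s) ∧ |table e r L k s| ≤ 2 ^ k := by
  induction k using Nat.strong_induction_on with
  | _ k ih =>
    intro hk L hL s
    cases k with
    | zero =>
      obtain rfl : L = 0 := by omega
      rw [table]
      split_ifs
      · exact ⟨HasDen.one _, by simp⟩
      · exact ⟨HasDen.zero _, by simp⟩
    | succ p =>
      rw [table_eq_sum e r p s L hL]
      split_ifs
      · have hl : ∀ l ∈ Finset.range L, l ≤ p := fun l hl => by
          have := Finset.mem_range.1 hl; omega
        constructor
        · refine HasDen.sum _ fun l hm => ?_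
          have h := (ih l (by have := hl l hm; omega) (by have := hl l hm; omega) l le_rfl
            (s - e p)).1.mul (hr l p (hl l hm) (by omega)).1
          rw [← pow_succ] at h
          exact h.mono (pow_dvd_pow B (by have := hl l hm; omega))
        · refine (Finset.abs_sum_le_sum_abs _ _).trans ((Finset.sum_le_sum fun l hm => ?_).trans
            ((sum_two_pow_le L).trans (pow_le_pow_right₀ one_le_two hL)))
          rw [abs_mul]
          exact (mul_le_of_le_one_right (abs_nonneg _) (hr l p (hl l hm) (by omega)).2).trans
            (ih l (by have := hl l hm; omega) (by have := hl l hm; omega) l le_rfl (s - e p)).2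
      · exact ⟨HasDen.zero _, by rw [abs_zero]; positivity⟩

theorem shapWeight_bound {n t : ℕ} (ht : t ≤ n) :
    HasDen (n + 1).factorial (shapWeight n t) ∧ |shapWeight n t| ≤ 1 := by
  have hpos : (0 : ℝ) < (n + 1).factorial := by exact_mod_cast Nat.factorial_pos _
  constructor
  · refine ⟨((t.factorial * (n - t).factorial : ℕ) : ℤ), ?_⟩
    rw [shapWeight, div_mul_cancel₀ _ hpos.ne', Int.cast_natCast]
  · rw [shapWeight, abs_of_nonneg (by positivity), div_le_one hpos]
    have h1 := Nat.factorial_mul_factorial_dvd_factorial ht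
    exact_mod_cast (Nat.le_of_dvd (Nat.factorial_pos n) h1).trans
      (Nat.factorial_le (Nat.le_succ n))

end Bounds

/-! ### Size bounds and scores of an instance -/

section Instances
variable (I : ShapInstance)

theorem isStochastic_weight : IsStochastic I.P.weight := by
  constructor
  · intro k a b
    unfold BoolMarkov.weight
    split_ifs
    · exact (I.P.init_pos _).le
    · exact (I.P.trans_pos _ _ _).le
    · exact le_rfl
    · exact zero_le_one
  · intro k a
    by_cases h0 : k = 0
    · simp only [BoolMarkov.weight, if_pos h0]
      exact I.P.init_sum
    · by_cases h1 : k - 1 < I.n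
      · simp only [BoolMarkov.weight, if_neg h0, dif_pos h1]
        exact I.P.trans_sum _ _
      · simp [BoolMarkov.weight, h0, h1]

theorem clauseFilter_eq (m k : ℕ) (b : Bool) :
    I.clauseFilter m k b = 0 ∨ I.clauseFilter m k b = 1 := by
  unfold ShapInstance.clauseFilter
  split_ifs
  · unfold Clause.filter
    split_ifs <;> simp
  · exact noFilter_eq k b

/-- Every natural number in the representation costs at least one bit, and the incidence tables
alone have a multiple of M entries. -/
theorem le_bitLength : I.n + 1 ≤ shapProblem.bitLength I ∧ I.M ≤ shapProblem.bitLength I := by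
  have h : (I.natData.flatten.map fun n => n.size + 1).length ≤
      (I.natData.flatten.map fun n => n.size + 1).sum :=
    List.length_le_sum_of_one_le _ fun k hk => by
      obtain ⟨q, _, rfl⟩ := List.mem_map.1 hk
      omega
  have hlen : (I.natData.flatten.map fun n => n.size + 1).length =
      3 + ((I.n + 1) + (I.M * (I.n + 1) + I.M * (I.n + 1))) := by
    simp only [ShapInstance.natData, List.length_map, List.length_flatten, List.map_cons,
      List.length_cons, List.length_nil, List.length_ofFn, List.map_nil, List.sum_cons,
      List.sum_nil]
    omega
  have hb : (I.natData.flatten.map fun n => n.size + 1).sum ≤ shapProblem.bitLength I :=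
    Nat.le_add_right _ _
  rw [hlen] at h
  constructor <;> nlinarith

/-- The bound for the bit lengths, in terms of the bit length of the instance. -/
def bitPoly (L : ℕ) : ℕ :=
  (L + 2) * (L + 1) + L + (L * L + (L + 1) + 2 * (L * L + L * ((L + 1) * ((L + 1) * (L + 1)) *
    (L + 1))) + 3)

theorem mem_numData_init (b : Bool) : I.P.init b ∈ I.numData.flatten := by
  cases b <;> simp [ShapInstance.numData]

theorem mem_numData_trans (k : Fin I.n) (a b : Bool) : I.P.trans k a b ∈ I.numData.flatten := by
  cases a <;> cases b <;> simp [ShapInstance.numData, List.mem_ofFn]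

theorem bitBound (δ : ℕ) :
    BitBound (shapProblem.IsRational I) (bitPoly (shapProblem.bitLength I)) δ I := by
  by_cases hR : shapProblem.IsRational I
  swap
  -- For irrational data all size bounds are vacuous; only the step count matters.
  · constructor <;> exact fun h => absurd h hR
  set L := shapProblem.bitLength I with hL
  obtain ⟨hn, hM⟩ := le_bitLength I
  rw [← hL] at hn hM
  obtain ⟨D, hD0, hDle, hDall⟩ := exists_common_den I.numData.flatten fun r hr => by
    obtain ⟨l, hl, hr⟩ := List.mem_flatten.1 hr
    exact hR l hl r hr
  have hsum : (I.numData.flatten.map numBits).sum ≤ L := Nat.le_add_left _ _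
  replace hDle : D ≤ 2 ^ L := hDle.trans (Nat.pow_le_pow_right two_pos hsum)
  have hD : ∀ k a b, HasDen D (I.P.weight k a b) := by
    intro k a b
    unfold BoolMarkov.weight
    split_ifs
    · exact hDall _ (mem_numData_init I b)
    · exact hDall _ (mem_numData_trans I _ a b)
    · exact HasDen.zero _
    · exact HasDen.one _
  have hT := isStochastic_weight I
  obtain ⟨K, hK⟩ : ∃ K, K = I.n + 2 := ⟨_, rfl⟩
  have hKL : K ≤ L + 1 := by omega
  obtain ⟨B, hB0, hBle, hB⟩ := exists_hasDen_segRatio (x := extend I.x) hT hD0 hD I.i K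
  have hpow : ∀ j, D ^ j ≤ 2 ^ (L * j) := fun j => by
    rw [pow_mul]; exact Nat.pow_le_pow_left hDle j
  -- D ≤ 2^L and B ≤ D^(K³); the last row of the table needs B^K.
  have hBK : B ^ K ≤ 2 ^ (L * (K * (K * K) * K)) := by
    rw [← mul_assoc, pow_mul]
    exact Nat.pow_le_pow_left (hBle.trans (hpow _)) K
  have hcube : L * (K * (K * K) * K) ≤ L * ((L + 1) * ((L + 1) * (L + 1)) * (L + 1)) := by gcongr
  have hlin : L * K ≤ L * (K * (K * K) * K) := by
    refine Nat.mul_le_mul_left _ ?_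
    exact Nat.le_mul_of_pos_left _ (by rw [hK]; positivity)
  have htab : ∀ m L' k s, L' ≤ k → k ≤ K → HasDen (B ^ K) (I.tab m L' k s) ∧
      |I.tab m L' k s| ≤ 2 ^ K := by
    intro m L' k s hLk hk
    obtain ⟨h1, h2⟩ := table_bound (e := counted I.i) (r := I.seg m)
      (fun l k hlk hk => hB _ (clauseFilter_eq I m) l k hlk hk) k hk L' hLk s
    exact ⟨h1.mono (pow_dvd_pow B hk), h2.trans (pow_le_pow_right₀ one_le_two hk)⟩
  have hvec : ∀ u : ℕ → Bool → ℝ, (∀ k b, u k b = 0 ∨ u k b = 1) → ∀ l d b, d ≤ I.n + 2 →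
      numBits (I.vec u l d b) ≤ bitPoly L := by
    intro u hu l d b hd
    have h := numBits_le (g := 0) (pow_pos hD0 K) (hpow K)
      ((HasDen.fwd (x := extend I.x) hD hu l d b).mono (pow_dvd_pow D (hK ▸ hd))) (by
        rw [abs_of_nonneg (fwd_nonneg hT hu l d b), pow_zero]
        exact (fwd_le_noFilter hT hu l d b).trans (fwd_noFilter_le_one hT l d b))
    refine h.trans ?_
    unfold bitPoly
    omega
  constructor
  · intro _
    have : (I.n + 3) * (I.n + 2) ≤ (L + 2) * (L + 1) :=
      Nat.mul_le_mul (by omega) (by omega)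
    unfold bitPoly
    omega
  · intro _ j hj
    have h1 : j.factorial.size ≤ j * j + 1 :=
      Nat.size_le.2 ((factorial_le_two_pow j).trans_lt
        (Nat.pow_lt_pow_right one_lt_two (Nat.lt_succ_self _)))
    have h2 : j * j ≤ L * L := Nat.mul_le_mul (by omega) (by omega)
    unfold bitPoly
    omega
  · intro _
    have := numBits_le (d := 1) (g := 0) (h := 0) one_pos le_rfl (HasDen.zero 1) (by simp)
    unfold bitPoly
    omega
  · intro _
    have := numBits_le (d := 1) (g := 0) (h := 0) one_pos le_rfl (HasDen.one 1) (by simp)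
    unfold bitPoly
    omega
  · intro _ b
    have := List.single_le_sum (l := I.numData.flatten.map numBits) (fun _ _ => Nat.zero_le _) _
      (List.mem_map_of_mem (mem_numData_init I b))
    unfold bitPoly
    omega
  · exact fun _ m l d b hd => hvec _ (clauseFilter_eq I m) l d b hd
  · exact fun _ l d b hd => hvec _ noFilter_eq l d b hd
  · intro _ m L' k s hLk hk
    obtain ⟨h1, h2⟩ := htab m L' k s hLk (hK ▸ hk)
    have := numBits_le (pow_pos hB0 K) hBK h1 h2
    unfold bitPoly
    omega
  · intro _ m s hm hs
    have hcon : ∀ m' s', s' < I.n + 1 - δ →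
        HasDen ((I.n + 1).factorial * B ^ K) (I.contribution δ m' s') ∧
          |I.contribution δ m' s'| ≤ 2 ^ K := by
      intro m' s' hs'
      obtain ⟨h1, h2⟩ := shapWeight_bound (n := I.n) (t := s' + δ) (by omega)
      obtain ⟨h3, h4⟩ := htab m' (I.n + 2) (I.n + 2) (s' + 1) le_rfl hK.ge
      refine ⟨h1.mul h3, ?_⟩
      rw [ShapInstance.contribution, abs_mul]
      exact (mul_le_of_le_one_left (abs_nonneg _) h2).trans h4
    have hden : HasDen ((I.n + 1).factorial * B ^ K) (I.partialScore δ m s) :=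
      (HasDen.sum _ fun m' _ => HasDen.sum _ fun s' hs' =>
        (hcon m' s' (Finset.mem_range.1 hs')).1).add
      (HasDen.sum _ fun s' hs' => (hcon m s' ((Finset.mem_range.1 hs').trans_le hs)).1)
    -- At most L² summands have been accumulated, each of absolute value at most 2^K.
    have habs : |I.partialScore δ m s| ≤ 2 ^ (L * L + K) := by
      have h1 : ∀ m' t, t ≤ I.n + 1 - δ →
          |∑ s' ∈ Finset.range t, I.contribution δ m' s'| ≤ (t : ℝ) * 2 ^ K := by
        intro m' t ht
        refine (Finset.abs_sum_le_sum_abs _ _).trans ((Finset.sum_le_card_nsmul _ _ _ fun s' hs' =>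
          (hcon m' s' ((Finset.mem_range.1 hs').trans_le ht)).2).trans ?_)
        rw [Finset.card_range, nsmul_eq_mul]
      have h2 : |∑ m' ∈ Finset.range m, ∑ s' ∈ Finset.range (I.n + 1 - δ),
          I.contribution δ m' s'| ≤ (m : ℝ) * (((I.n + 1 - δ : ℕ) : ℝ) * 2 ^ K) := by
        refine (Finset.abs_sum_le_sum_abs _ _).trans ((Finset.sum_le_card_nsmul _ _ _ fun m' _ =>
          h1 m' _ le_rfl).trans ?_)
        rw [Finset.card_range, nsmul_eq_mul]
      have h3 : (m * (I.n + 1 - δ) + s : ℕ) ≤ 2 ^ (L * L) := by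
        have : m * (I.n + 1 - δ) + s ≤ L * L := by
          have h4 : (m + 1) * (I.n + 1 - δ) ≤ L * L := Nat.mul_le_mul (by omega) (by omega)
          rw [add_mul, one_mul] at h4
          omega
        exact this.trans Nat.lt_two_pow_self.le
      have h5 : ((m * (I.n + 1 - δ) + s : ℕ) : ℝ) ≤ 2 ^ (L * L) := by exact_mod_cast h3
      calc |I.partialScore δ m s| ≤ _ := abs_add_le _ _
        _ ≤ (m : ℝ) * (((I.n + 1 - δ : ℕ) : ℝ) * 2 ^ K) + (s : ℝ) * 2 ^ K :=
          add_le_add h2 (h1 m s hs)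
        _ = ((m * (I.n + 1 - δ) + s : ℕ) : ℝ) * 2 ^ K := by push_cast; ring
        _ ≤ 2 ^ (L * L) * 2 ^ K := by gcongr
        _ = 2 ^ (L * L + K) := (pow_add _ _ _).symm
    have hdle : (I.n + 1).factorial * B ^ K ≤ 2 ^ (L * L + L * (K * (K * K) * K)) := by
      rw [pow_add]
      refine Nat.mul_le_mul ((factorial_le_two_pow _).trans
        (Nat.pow_le_pow_right two_pos (Nat.mul_le_mul hn hn))) hBK
    have := numBits_le (Nat.mul_pos (Nat.factorial_pos _) (pow_pos hB0 K)) hdle hden habs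
    unfold bitPoly
    omega

/-- The polynomial bound for the number of steps. -/
def timePoly (W : ℕ) : ℕ :=
  7 + ((1 + (W * (1 + 2) + 2)) + (W * (((W * W * (1 + 2) + 2) + (1 +
    ((W * ((2 + (2 + (W * (2 + (2 + (W * (1 + 2) + 2)) + 2) + 2))) + 2) + 2) +
      (W * (1 + 2) + 2)))) + 2) + 2))

theorem partialScore_eq_sum (δ : ℕ) : I.partialScore δ I.M 0 =
    ∑ m, ∑ s ∈ Finset.range (I.n + 1 - δ), shapWeight I.n (s + δ) *
      table (counted I.i) (segRatio I.P.weight (extend I.x) (I.dnf.clause m).filter I.i)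
        (I.n + 2) (I.n + 2) (s + 1) := by
  rw [ShapInstance.partialScore, Finset.sum_range_zero, add_zero, Finset.sum_range]
  refine Finset.sum_congr rfl fun m _ => Finset.sum_congr rfl fun s _ => ?_
  have h : I.clauseFilter m = (I.dnf.clause m).filter := dif_pos m.isLt
  simp only [ShapInstance.contribution, ShapInstance.tab]
  congr 2
  funext l k
  rw [ShapInstance.seg, h]

theorem partialScore_eq_shap : I.partialScore 0 I.M 0 = shap I.dnf.value I.x I.i I.P := by
  rw [partialScore_eq_sum, shap_eq]
  rfl

theorem partialScore_eq_shapAlt :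
    I.partialScore 1 I.M 0 = shapAlt I.dnf.value I.x I.i I.P := by
  rw [partialScore_eq_sum, shapAlt_eq]
  rfl

end Instances

open Polynomial in
theorem exists_polynomials : ∃ p q : Polynomial ℕ, (∀ w, p.eval w = timePoly (w + 2)) ∧
    ∀ w, q.eval w = bitPoly w := by
  refine ⟨7 + ((1 + ((X + 2) * (1 + 2) + 2)) + ((X + 2) * ((((X + 2) * (X + 2) * (1 + 2) + 2) + (1 +
    (((X + 2) * ((2 + (2 + ((X + 2) * (2 + (2 + ((X + 2) * (1 + 2) + 2)) + 2) + 2))) + 2) + 2) +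
      ((X + 2) * (1 + 2) + 2)))) + 2) + 2)),
    (X + 2) * (X + 1) + X + (X * X + (X + 1) + 2 * (X * X + X * ((X + 1) * ((X + 1) * (X + 1)) *
    (X + 1))) + 3), fun w => ?_, fun w => ?_⟩
  · simp [timePoly]
  · simp [bitPoly]

/-- The single loop bound N + M + 2 dominates both the number n + 3 of positions and the number of
clauses. -/
theorem exists_exec (δ : ℕ) (I : ShapInstance) : ∃ t s σ, Exec (Code.main δ) I.input t s σ ∧
    t ≤ timePoly (I.n + 1 + I.M + 2) ∧
    (shapProblem.IsRational I → s ≤ bitPoly (shapProblem.bitLength I)) ∧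
    σ.num 0 0 = I.partialScore δ I.M 0 :=
  runs_main (W := I.n + 1 + I.M + 2) (bitBound I δ) (by omega) (by omega)

end ShapMarkov

end

theorem theorem2 :
    ShapMarkov.shapProblem.InFP ∧ ShapMarkov.shapAltProblem.InFP := by
  obtain ⟨p, q, hp, hq⟩ := ShapMarkov.exists_polynomials
  constructor
  · refine ⟨ShapMarkov.Code.main 0, p, q, fun I => ?_⟩
    obtain ⟨t, s, σ, h, ht, hs, ho⟩ := ShapMarkov.exists_exec 0 I
    exact ⟨t, s, σ, h, ho.trans (ShapMarkov.partialScore_eq_shap I), by rw [hp]; exact ht,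
      by rw [hq]; exact hs⟩
  · refine ⟨ShapMarkov.Code.main 1, p, q, fun I => ?_⟩
    obtain ⟨t, s, σ, h, ht, hs, ho⟩ := ShapMarkov.exists_exec 1 I
    exact ⟨t, s, σ, h, ho.trans (ShapMarkov.partialScore_eq_shapAlt I), by rw [hp]; exact ht,
      by rw [hq]; exact hs⟩
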